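/- **Theorem (probability generating function for $\sigma_k$).** Let $\lambda\ge 0$, let $k\ge 2$ be an integer and let $\frac1k<r_0<\frac1{k-1}$. Let $\mathcal P_\lambda$ be a homogeneous Poisson point process on $[0,1]$ with intensity $\lambda$ times Lebesgue measure. Let $G$ be the graph with vertex set $\mathcal P_\lambda\cup\{0,1\}$ in which two distinct vertices $x,y$ are joined if and only if $|x-y|<r_0$, and let $\sigma_k$ be the number of paths with exactly $k$ edges (and no repeated vertices) from $0$ to $1$ in $G$. For $1\le j\le k-1$ put $L_j=B(0,jr_0)\cap B(1,(k-j)r_0)$, where $B(a,b)$ is the open ball with centre $a$ and radius $b$. Let $m_1,\dots,m_{k-1}\ge 0$ be integers such that the event $E=\{\#(\mathcal P_\lambda\cap L_j)=m_j \text{ for } 1\le j\le k-1\}$ has positive probability (for $\lambda>0$ this is always so). Then, for every $q\in\mathbb C$, the conditional expectation of $q^{\sigma_k}$ given $E$ exists and $$\mathbb E\big[q^{\sigma_k}\,\big|\,E\big]=\frac{1}{\binom{m_1+\cdots+m_{k-1}}{m_1,\dots,m_{k-1}}}\,[u^{m_{k-1}}]\sum_{\Pi\in\mathcal P(\mathcal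 M_{k-2})}\ \prod_{t=0}^{m_{k-2}}\frac{1}{\big(1-uq^{S_t(\Pi)}\big)^{1+\sum_{l=1}^{k-3}\pi^\star_{k-2,l}(t)}} .$$ Here $[u^n]A(u)$ is the coefficient of $u^n$ in the formal power series $A(u)$, and the other symbols are defined as follows, with $d=k-2$. * $\mathcal P(\mathcal M_d)$ is the set of lattice paths from $\mathbf 0$ to $(m_1,\dots,m_d)$ with steps in $\{e_1,\dots,e_d\}$, i.e. of the sequences in which $e_i$ occurs exactly $m_i$ times for $1\le i\le d$. * For $\Pi\in\mathcal P(\mathcal M_d)$ and $a\ne b$, $\pi_{a,b}$ is the integer partition below the projection of $\Pi$ onto the $(e_a,e_b)$-face: $\pi_{a,b}(t)$, $1\le t\le m_b$, is the number of steps $e_a$ that precede the $t$-th step $e_b$. So $\pi_{b,a}$ is the complementary Ferrers diagram of $\pi_{a,b}$. The multiplicity $\pi^\star_{a,b}(t)$ is the number of parts of $\pi_{a,b}$ that are equal to $t$. * $S_t(\Pi)=t$ if $d=1$, and for $d\ge2$ $$S_t(\Pi)=\sum_{i_{d-1}=1}^{t}\ \sum_{i_{d-2}=1}^{\pi_{d-1,d}(i_{d-1})}\cdots\sum_{i_1=1}^{\pi_{2,3}(i_2)}\pi_{1,2}(i_1).$$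 * For $k=2$ the lattice is a single point: $\mathcal P(\mathcal M_0)$ consists of the empty path only, $m_0=0$ and $S_0=1$, so that the right-hand side is $[u^{m_1}](1-uq)^{-1}=q^{m_1}$. -/

import Mathlib

open MeasureTheory ProbabilityTheory
open scoped NNReal ENNReal

namespace RGG1d

noncomputable section

/-! ### The Poisson process and the random geometric graph -/

/-- The number of points of the finite configuration `X` which lie in `B`. -/
def pointCount (X : Finset ℝ) (B : Set ℝ) : ℕ := ((X : Set ℝ) ∩ B).ncard

/-- `X` is a homogeneous Poisson point process on `[0,1]` of intensity `lam` times Lebesgue measure,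
realised as a random finite subset of `[0,1]`: the number of points in a Borel set `B ⊆ [0,1]` is a
Poisson random variable with mean `lam * |B|`, and the numbers of points in finitely many pairwise
disjoint Borel sets are independent. -/
structure IsPoissonProcess {Ω : Type*} [MeasurableSpace Ω] (P : Measure Ω) (lam : ℝ≥0)
    (X : Ω → Finset ℝ) : Prop where
  subset_Icc : ∀ ω, (X ω : Set ℝ) ⊆ Set.Icc 0 1
  measurable_count : ∀ B : Set ℝ, MeasurableSet B → Measurable fun ω => pointCount (X ω) B
  map_count : ∀ B : Set ℝ, MeasurableSet B → B ⊆ Set.Icc 0 1 →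
    P.map (fun ω => pointCount (X ω) B) = poissonMeasure (lam * (volume B).toNNReal)
  indep_count : ∀ (n : ℕ) (B : Fin n → Set ℝ), (∀ i, MeasurableSet (B i)) →
    (∀ i, B i ⊆ Set.Icc 0 1) → Pairwise (fun i j => Disjoint (B i) (B j)) →
    iIndepFun (fun i ω => pointCount (X ω) (B i)) P

/-- The vertex set: the points of the configuration together with the two endpoints `0` and `1`. -/
def vertices (X : Finset ℝ) : Finset ℝ := insert 0 (insert 1 X)

lemma zero_mem_vertices (X : Finset ℝ) : (0 : ℝ) ∈ vertices X := by simp [vertices]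

lemma one_mem_vertices (X : Finset ℝ) : (1 : ℝ) ∈ vertices X := by simp [vertices]

/-- The hard random geometric graph with connection range `r`: distinct vertices are joined if and
only if their distance is less than `r`. -/
def graph (r : ℝ) (X : Finset ℝ) : SimpleGraph {x : ℝ // x ∈ vertices X} where
  Adj x y := x ≠ y ∧ |(x : ℝ) - (y : ℝ)| < r
  symm := ⟨fun _ _ h => ⟨h.1.symm, by rw [abs_sub_comm]; exact h.2⟩⟩
  loopless := ⟨fun _ h => h.1 rfl⟩

/-- `σ_k`: the number of `k`-hop paths (paths with exactly `k` edges, no repeated vertices) from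
the vertex `0` to the vertex `1`. -/
def hopCount (k : ℕ) (r : ℝ) (X : Finset ℝ) : ℕ :=
  Nat.card {p : (graph r X).Walk ⟨0, zero_mem_vertices X⟩ ⟨1, one_mem_vertices X⟩ //
    p.IsPath ∧ p.length = k}

/-- The lens `L_j = B(0, j r) ∩ B(1, (k - j) r)`. -/
def lens (k : ℕ) (r : ℝ) (j : ℕ) : Set ℝ :=
  Metric.ball 0 (j * r) ∩ Metric.ball 1 (((k : ℝ) - j) * r)

/-! ### Lattice paths

Only the entries `m 1, …, m d` of the side lengths `m : ℕ → ℕ` of a `d`-dimensional lattice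
matter. The step in the direction `e_i`, `1 ≤ i ≤ d`, is encoded by the number `i`. -/

/-- The number of steps `e_i` of the path `p`. -/
def stepCount {N : ℕ} (p : Fin N → ℕ) (i : ℕ) : ℕ := (Finset.univ.filter fun s => p s = i).card

/-- The sequence of steps `p` is a lattice path from `0` to `(m_1, …, m_d)` with steps among
`e_1, …, e_d`: for each `i`, the step `e_i` occurs `m_i` times. -/
def IsLatticePath (d : ℕ) (m : ℕ → ℕ) {N : ℕ} (p : Fin N → ℕ) : Prop :=
  (∀ s, p s ∈ Finset.Icc 1 d) ∧ ∀ i ∈ Finset.Icc 1 d, stepCount p i = m i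

instance (d : ℕ) (m : ℕ → ℕ) {N : ℕ} (p : Fin N → ℕ) : Decidable (IsLatticePath d m p) :=
  inferInstanceAs (Decidable (_ ∧ _))

/-- All sequences of `N` steps among `e_1, …, e_d`. -/
def stepSequences (N d : ℕ) : Finset (Fin N → ℕ) := Fintype.piFinset fun _ => Finset.Icc 1 d

/-- The set `P(M_d)` of all lattice paths from `0` to `(m_1, …, m_d)`; such a path has
`m_1 + ⋯ + m_d` steps. For `d = 0` the only one is the empty path. -/
def latticePaths (d : ℕ) (m : ℕ → ℕ) : Finset (Fin (∑ i ∈ Finset.Icc 1 d, m i) → ℕ) :=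
  (stepSequences (∑ i ∈ Finset.Icc 1 d, m i) d).filter fun p => IsLatticePath d m p

lemma mem_latticePaths (d : ℕ) (m : ℕ → ℕ) (p : Fin (∑ i ∈ Finset.Icc 1 d, m i) → ℕ) :
    p ∈ latticePaths d m ↔ IsLatticePath d m p := by
  rw [latticePaths, Finset.mem_filter]
  exact and_iff_right_of_imp fun h => Fintype.mem_piFinset.2 h.1

/-- The integer partition `π_{a,b}` below the projection of the path `p` on the `(e_a, e_b)`-face:
its parts, one for each step `e_b` in the order of the path, are the numbers of steps `e_a` which
precede that step `e_b`. So it is a weakly increasing sequence of `m_b` integers between `0` and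
`m_a`, and `π_{b,a}` is the complementary Ferrers diagram of `π_{a,b}`. -/
def partition {N : ℕ} (p : Fin N → ℕ) (a b : ℕ) : List ℕ :=
  ((List.finRange N).filter fun s => p s = b).map fun s =>
    (Finset.univ.filter fun s' => s' < s ∧ p s' = a).card

/-- The part `π_{a,b}(t)`, for `t = 1, …, m_b`. -/
def part {N : ℕ} (p : Fin N → ℕ) (a b t : ℕ) : ℕ := (partition p a b).getD (t - 1) 0

/-- The multiplicity `π⋆_{a,b}(t)` of the integer `t` among the parts of `π_{a,b}`. -/
def multiplicity {N : ℕ} (p : Fin N → ℕ) (a b t : ℕ) : ℕ := (partition p a b).count t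

/-- `S_t` of a `d`-dimensional lattice path `p`, that is
`∑_{i_{d-1} = 1}^{t} ∑_{i_{d-2} = 1}^{π_{d-1,d}(i_{d-1})} ⋯ ∑_{i_1 = 1}^{π_{2,3}(i_2)} π_{1,2}(i_1)`
for `d ≥ 2`, and `S_t = t` for `d = 1`. For the empty path (`d = 0`), `S_t = 1` by convention. -/
def partialVolume {N : ℕ} (p : Fin N → ℕ) : ℕ → ℕ → ℕ
  | 0, _ => 1
  | 1, t => t
  | d + 2, t => ∑ i ∈ Finset.Icc 1 t, partialVolume p (d + 1) (part p (d + 1) (d + 2) i)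

/-- The side length `m_d`, with the convention `m_0 = 0`. -/
def side (m : ℕ → ℕ) : ℕ → ℕ
  | 0 => 0
  | d + 1 => m (d + 1)

/-- The formal power series in `u`
`∑_{Π ∈ P(M_d)} ∏_{t=0}^{m_d} (1 - u q^{S_t(Π)})^{-(1 + ∑_{l=1}^{d-1} π⋆_{d,l}(t))}`. -/
def pathSeries (d : ℕ) (m : ℕ → ℕ) (q : ℂ) : PowerSeries ℂ :=
  ∑ p ∈ latticePaths d m, ∏ t ∈ Finset.range (side m d + 1),
    ((1 - PowerSeries.X * PowerSeries.C (q ^ partialVolume p d t)) ^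
      (1 + ∑ l ∈ Finset.Icc 1 (d - 1), multiplicity p d l t))⁻¹

end

end RGG1d

open RGG1d

/-!
For `1/k < r < 1/(k-1)` the lenses `L_1, …, L_{k-1}` are disjoint translates of one interval, `L_j`
being `L_1` shifted by `(j-1) r`, and the `j`-th inner vertex of a `k`-hop path from `0` to `1`
lies in `L_j`. Two points of `L_j` and `L_{j+1}` are joined if and only if the relative position of
the first in its lens exceeds that of the second. Hence, if the points of all lenses are sorted by
their relative positions and each is labelled by its lens, the number of `k`-hop paths is the
number of subsequences `1, 2, …, k-1` of the resulting word, read from large to small relative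
positions (`chainCount`, `hopCount_eq_chainCount`). A walk with `k` edges from `0` to `1` is
automatically a path because no shorter walk exists, so paths are counted by a power of the
adjacency matrix.

Conditionally on the numbers `m_j` of points in the lenses, this word is uniformly distributed
among the words with letter counts `m_j`. To see this, each lens is cut into `n` congruent cells.
The numbers of points in the cells are independent with the same Poisson law. When each column (the
union of the cells with a common index) contains at most one point, the configuration is described
by a word with `n` letters in which `0` marks an empty column; the probability of such a word
depends on its letter counts only (`IsPoissonProcess.measure_hasWord`), and every word without `0`
is padded with zeros in the same number of ways (`sum_paddedWords`). Some column contains two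
points with probability `O(1/n)` (`IsPoissonProcess.measureReal_exists_column_le`), so the average
over words is the conditional expectation in the limit (`integrableOn_and_setIntegral_eq`). The
same exhaustion provides the almost everywhere measurability and the boundedness of `q ^ σ_k`.

It remains to enumerate words by their number of chains. A word in `1, …, d+1` arises from a word
`w` in `1, …, d`, that is from a lattice path, by inserting the letters `d+1`. A letter inserted at
a given place completes as many chains as there are chains `1, …, d` in the portion of the path
before that place, which is `S_t` if that portion contains `t` steps `e_d`
(`partialVolume_of_suffix`). Thus each place contributes a geometric series
`(1 - u q^{S_t})⁻¹` (`mk_sum_insertions`), and there are `1 + ∑_l π⋆_{d,l}(t)` places for each `t`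
(`prod_tails_count`). This is `coeff_pathSeries`.

Words are lists whose head is the label of the smallest relative position, that is the last step of
the lattice path, so that a recursion on lists adds a step at the end of the path.
-/

namespace RGG1d

/-! ### Chains in a word -/

/-- The number of occurrences of the word `j, j - 1, …, 1` as a subsequence of `w`, that is, of
`1, 2, …, j` as a subsequence of `w` read from right to left. -/
def chainCount : List ℕ → ℕ → ℕ
  | _, 0 => 1
  | [], _ + 1 => 0
  | a :: w, j + 1 => chainCount w (j + 1) + if a = j + 1 then chainCount w j else 0

lemma chainCount_zero (w : List ℕ) : chainCount w 0 = 1 := by cases w <;> rfl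

lemma chainCount_nil_succ (j : ℕ) : chainCount [] (j + 1) = 0 := rfl

lemma chainCount_cons_succ (a : ℕ) (w : List ℕ) (j : ℕ) :
    chainCount (a :: w) (j + 1) =
      chainCount w (j + 1) + if a = j + 1 then chainCount w j else 0 := rfl

/-- Letters which do not belong to the chain may be erased. -/
lemma chainCount_filter (z : ℕ) (w : List ℕ) (j : ℕ) (h : z = 0 ∨ j < z) :
    chainCount (w.filter (· ≠ z)) j = chainCount w j := by
  induction w generalizing j with
  | nil => rfl
  | cons a w ih =>
    cases j with
    | zero => simp only [chainCount_zero]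
    | succ j =>
      by_cases ha : a = z
      · rw [List.filter_cons_of_neg (by simpa using ha), ih _ h, chainCount_cons_succ,
          if_neg (by omega), add_zero]
      · rw [List.filter_cons_of_pos (by simpa using ha), chainCount_cons_succ,
          chainCount_cons_succ, ih _ h, ih _ (by omega)]

/-! ### Inserting a new letter into a word -/

/-- The words obtained from `p` by inserting `n` letters `z` (for `z ∉ p`). -/
def insertions (z : ℕ) : List ℕ → ℕ → Finset (List ℕ)
  | p, 0 => {p}
  | [], n + 1 => (insertions z [] n).map ⟨List.cons z, List.cons_injective⟩
  | a :: p, n + 1 => (insertions z (a :: p) n).map ⟨List.cons z, List.cons_injective⟩ ∪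
      (insertions z p (n + 1)).map ⟨List.cons a, List.cons_injective⟩

lemma insertions_zero (z : ℕ) (p : List ℕ) : insertions z p 0 = {p} := by
  cases p <;> rw [insertions]

lemma mem_insertions {z : ℕ} {w p : List ℕ} {n : ℕ} (hz : z ∉ p) :
    w ∈ insertions z p n ↔ w.filter (· ≠ z) = p ∧ w.count z = n := by
  induction w generalizing p n with
  | nil =>
    cases n with
    | zero => simp [insertions_zero, eq_comm]
    | succ n => cases p <;> simp [insertions]
  | cons x w ih =>
    by_cases hx : x = z
    · subst hx
      cases n with
      | zero =>
        rw [insertions_zero, Finset.mem_singleton]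
        simp only [List.count_cons_self, Nat.succ_ne_zero, and_false, iff_false]
        rintro rfl
        simp at hz
      | succ n =>
        have key : x :: w ∈ insertions x p (n + 1) ↔ w ∈ insertions x p n := by
          cases p with
          | nil => simp [insertions]
          | cons a p =>
            simp only [List.mem_cons, not_or] at hz
            simp [insertions, Ne.symm hz.1]
        rw [key, ih hz]
        simp
    · have key : x :: w ∈ insertions z p n ↔ ∃ p', p = x :: p' ∧ w ∈ insertions z p' n := by
        cases n with
        | zero => simp [insertions_zero, eq_comm]
        | succ n =>
          cases p with
          | nil => simp [insertions, Ne.symm hx]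
          | cons a p =>
            simp only [insertions, Finset.mem_union, Finset.mem_map,
              Function.Embedding.coeFn_mk, List.cons.injEq, Ne.symm hx, false_and, and_false,
              exists_false, false_or]
            constructor
            · rintro ⟨w', h, rfl, rfl⟩
              exact ⟨p, ⟨rfl, rfl⟩, h⟩
            · rintro ⟨p', ⟨rfl, rfl⟩, h⟩
              exact ⟨w, h, rfl, rfl⟩
      rw [key, List.filter_cons_of_pos (by simpa using hx), List.count_cons_of_ne hx]
      constructor
      · rintro ⟨p', rfl, h⟩
        rw [ih (by simp at hz; exact hz.2)] at h
        rw [h.1]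
        exact ⟨rfl, h.2⟩
      · rintro ⟨rfl, h⟩
        exact ⟨_, rfl, (ih (by simp)).2 ⟨rfl, h⟩⟩

/-- Splitting the insertions according to whether the first letter is the inserted one. -/
lemma sum_insertions_cons {M : Type*} [AddCommMonoid M] {z a : ℕ} (h : a ≠ z) (p : List ℕ) (n : ℕ)
    (f : List ℕ → M) :
    ∑ w ∈ insertions z (a :: p) (n + 1), f w =
      ∑ w ∈ insertions z (a :: p) n, f (z :: w) + ∑ w ∈ insertions z p (n + 1), f (a :: w) := by
  rw [insertions, Finset.sum_union, Finset.sum_map, Finset.sum_map]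
  · rfl
  · rw [Finset.disjoint_left]
    simp only [Finset.mem_map, Function.Embedding.coeFn_mk]
    rintro _ ⟨w, -, rfl⟩ ⟨w', -, h'⟩
    exact h (List.cons.inj h').1

lemma sum_insertions_nil {M : Type*} [AddCommMonoid M] (z n : ℕ) (f : List ℕ → M) :
    ∑ w ∈ insertions z [] (n + 1), f w = ∑ w ∈ insertions z [] n, f (z :: w) := by
  rw [insertions, Finset.sum_map]
  rfl

lemma card_insertions {z : ℕ} (p : List ℕ) (hz : z ∉ p) (n : ℕ) :
    (insertions z p n).card = (n + p.length).choose n := by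
  induction p generalizing n with
  | nil =>
    induction n with
    | zero => simp [insertions_zero]
    | succ n ih => simpa [insertions] using ih
  | cons a p ihp =>
    simp only [List.mem_cons, not_or] at hz
    induction n with
    | zero => simp [insertions_zero]
    | succ n ih =>
      rw [Finset.card_eq_sum_ones] at ih ⊢
      rw [sum_insertions_cons (Ne.symm hz.1), ih, ← Finset.card_eq_sum_ones, ihp hz.2,
        List.length_cons, show n + 1 + (p.length + 1) = (n + (p.length + 1)) + 1 by ring,
        Nat.choose_succ_succ, show n + 1 + p.length = n + (p.length + 1) by ring]

/-- The generating function of the insertions of the letter `d + 1` into `p`, weighted by the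
number of chains: a letter inserted in front of the suffix `s` of `p` completes
`chainCount s d` chains, whence one geometric series for each suffix. -/
lemma mk_sum_insertions (q : ℂ) (d : ℕ) (p : List ℕ) (hp : ∀ a ∈ p, a ≤ d) :
    PowerSeries.mk (fun n => ∑ w ∈ insertions (d + 1) p n, q ^ chainCount w (d + 1)) =
      (p.tails.map fun s =>
        (1 - PowerSeries.X * PowerSeries.C (q ^ chainCount s d))⁻¹).prod := by
  have hc : ∀ c : ℂ, PowerSeries.constantCoeff (1 - PowerSeries.X * PowerSeries.C c) ≠ 0 := by
    intro c; simp
  -- A word of the insertions into `s` has as many chains `1, …, d` as `s` itself.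
  have hfil : ∀ s : List ℕ, (∀ a ∈ s, a ≤ d) → ∀ n, ∀ w ∈ insertions (d + 1) s n,
      chainCount w d = chainCount s d := by
    intro s hs n w hw
    rw [mem_insertions (fun h => by have := hs _ h; omega)] at hw
    rw [← hw.1, chainCount_filter _ _ _ (by omega)]
  induction p with
  | nil =>
    rw [show ([] : List ℕ).tails = [[]] from rfl, List.map_singleton,
      List.prod_singleton, ← one_mul (_⁻¹), PowerSeries.eq_mul_inv_iff_mul_eq (hc _)]
    ext n
    rw [mul_sub, mul_one, ← mul_assoc, map_sub, PowerSeries.coeff_mul_C]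
    cases n with
    | zero => simp [insertions_zero, chainCount_nil_succ]
    | succ n =>
      rw [PowerSeries.coeff_succ_mul_X, PowerSeries.coeff_mk, PowerSeries.coeff_mk,
        sum_insertions_nil, Finset.sum_mul, ← Finset.sum_sub_distrib,
        PowerSeries.coeff_one, if_neg (by omega)]
      refine Finset.sum_eq_zero fun w hw => ?_
      rw [chainCount_cons_succ, if_pos rfl, hfil _ (by simp) _ _ hw, pow_add, sub_self]
  | cons a p ih =>
    have ha : a ≠ d + 1 := by have := hp a (by simp); omega
    rw [List.tails_cons, List.map_cons, List.prod_cons, ← ih fun b hb => hp b (by simp [hb]),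
      mul_comm, PowerSeries.eq_mul_inv_iff_mul_eq (hc _)]
    ext n
    rw [mul_sub, mul_one, ← mul_assoc, map_sub, PowerSeries.coeff_mul_C]
    cases n with
    | zero => simp [insertions_zero, chainCount_cons_succ, ha]
    | succ n =>
      rw [PowerSeries.coeff_succ_mul_X]
      simp only [PowerSeries.coeff_mk]
      rw [sum_insertions_cons ha, Finset.sum_mul, add_sub_right_comm, ← Finset.sum_sub_distrib,
        Finset.sum_eq_zero, zero_add]
      · refine Finset.sum_congr rfl fun w hw => ?_
        rw [chainCount_cons_succ, if_neg ha, add_zero]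
      · intro w hw
        rw [chainCount_cons_succ, if_pos rfl, hfil _ hp _ _ hw, pow_add, sub_self]

/-! ### Words with prescribed letter counts -/

/-- The words in the letters `1, …, d` in which the letter `i` occurs `m i` times. -/
def words : ℕ → (ℕ → ℕ) → Finset (List ℕ)
  | 0, _ => {[]}
  | d + 1, m => (words d m).biUnion fun p => insertions (d + 1) p (m (d + 1))

lemma mem_words {d : ℕ} {m : ℕ → ℕ} {w : List ℕ} :
    w ∈ words d m ↔ (∀ a ∈ w, a ∈ Finset.Icc 1 d) ∧ ∀ i ∈ Finset.Icc 1 d, w.count i = m i := by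
  induction d generalizing w with
  | zero =>
    simp only [words, Finset.mem_singleton]
    constructor
    · rintro rfl
      simp
    · rintro ⟨h, -⟩
      exact List.eq_nil_iff_forall_not_mem.2 fun a ha => by simpa using h a ha
  | succ d ih =>
    have hnot : ∀ p ∈ words d m, d + 1 ∉ p := fun p hp h => by
      have := (ih.1 hp).1 _ h
      simp at this
    rw [words, Finset.mem_biUnion]
    constructor
    · rintro ⟨p, hp, hw⟩
      rw [mem_insertions (hnot p hp)] at hw
      obtain ⟨rfl, hw⟩ := hw
      rw [ih] at hp
      constructor
      · intro a ha
        by_cases h : a = d + 1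
        · simp [h]
        · have := hp.1 a (List.mem_filter.2 ⟨ha, by simpa using h⟩)
          simp only [Finset.mem_Icc] at this ⊢
          omega
      · intro i hi
        by_cases h : i = d + 1
        · rw [h, hw]
        · rw [← hp.2 i (by simp only [Finset.mem_Icc] at hi ⊢; omega),
            List.count_filter (by simpa using h)]
    · rintro ⟨h1, h2⟩
      have hp : w.filter (· ≠ d + 1) ∈ words d m := by
        rw [ih]
        constructor
        · intro a ha
          rw [List.mem_filter] at ha
          have h3 := h1 a ha.1
          have h4 : a ≠ d + 1 := by simpa using ha.2
          simp only [Finset.mem_Icc] at h3 ⊢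
          omega
        · intro i hi
          simp only [Finset.mem_Icc] at hi
          rw [List.count_filter (by simp; omega), h2 i (by simp only [Finset.mem_Icc]; omega)]
      exact ⟨_, hp, (mem_insertions (hnot _ hp)).2 ⟨rfl, h2 _ (by simp)⟩⟩

lemma not_mem_of_mem_words {d z : ℕ} {m : ℕ → ℕ} {w : List ℕ} (hw : w ∈ words d m)
    (hz : z = 0 ∨ d < z) : z ∉ w := fun h => by
  have := (mem_words.1 hw).1 _ h
  simp only [Finset.mem_Icc] at this
  omega

/-- Distinct words stay distinct when a new letter is inserted. -/
lemma pairwiseDisjoint_insertions {d z : ℕ} (m : ℕ → ℕ) (hz : z = 0 ∨ d < z) (n : ℕ) :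
    Set.PairwiseDisjoint (words d m : Set (List ℕ)) fun p => insertions z p n := by
  intro p hp p' hp' hne
  refine Finset.disjoint_left.2 fun w hw hw' => hne ?_
  rw [mem_insertions (not_mem_of_mem_words hp hz)] at hw
  rw [mem_insertions (not_mem_of_mem_words hp' hz)] at hw'
  rw [← hw.1, hw'.1]

lemma sum_words_succ {M : Type*} [AddCommMonoid M] (d : ℕ) (m : ℕ → ℕ) (f : List ℕ → M) :
    ∑ w ∈ words (d + 1) m, f w =
      ∑ p ∈ words d m, ∑ w ∈ insertions (d + 1) p (m (d + 1)), f w :=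
  Finset.sum_biUnion (pairwiseDisjoint_insertions m (by omega) _)

lemma length_of_mem_words {d : ℕ} {m : ℕ → ℕ} {w : List ℕ} (hw : w ∈ words d m) :
    w.length = ∑ i ∈ Finset.Icc 1 d, m i := by
  rw [mem_words] at hw
  rw [← Finset.sum_congr rfl hw.2, ← Multiset.coe_card,
    ← Multiset.sum_count_eq_card (s := Finset.Icc 1 d) (m := (w : Multiset ℕ))
      (by simpa using hw.1)]
  simp only [Multiset.coe_count]

lemma card_words (d : ℕ) (m : ℕ → ℕ) :
    (words d m).card = Nat.multinomial (Finset.Icc 1 d) m := by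
  induction d with
  | zero => simp [words]
  | succ d ih =>
    rw [words, Finset.card_biUnion (pairwiseDisjoint_insertions m (by omega) _),
      ← Finset.insert_Icc_right_eq_Icc_add_one (by omega), Nat.multinomial_insert (by simp), ← ih,
      mul_comm, ← smul_eq_mul, ← Finset.sum_const]
    refine Finset.sum_congr rfl fun p hp => ?_
    rw [card_insertions p (not_mem_of_mem_words hp (by omega)), length_of_mem_words hp]

/-! ### Lattice paths as words -/

/-- The sequence of steps of a lattice path, as a word read from the last step to the first. -/
def reversedSteps {N : ℕ} (p : Fin N → ℕ) : List ℕ := (List.ofFn p).reverse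

lemma reversedSteps_succ {N : ℕ} (p : Fin (N + 1) → ℕ) :
    reversedSteps p = p (Fin.last N) :: reversedSteps fun s => p s.castSucc := by
  rw [reversedSteps, List.ofFn_succ', List.concat_eq_append, List.reverse_append]
  rfl

lemma reversedSteps_injective {N : ℕ} :
    Function.Injective (reversedSteps : (Fin N → ℕ) → List ℕ) := fun _ _ h =>
  List.ofFn_injective (List.reverse_injective h)

lemma mem_reversedSteps {N : ℕ} {p : Fin N → ℕ} {a : ℕ} :
    a ∈ reversedSteps p ↔ ∃ s, p s = a := by
  rw [reversedSteps, List.mem_reverse, List.mem_ofFn]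

lemma count_reversedSteps {N : ℕ} (p : Fin N → ℕ) (i : ℕ) :
    (reversedSteps p).count i = stepCount p i := by
  induction N with
  | zero => simp [reversedSteps, stepCount]
  | succ N ih =>
    rw [reversedSteps_succ, List.count_cons, ih, stepCount, stepCount, Finset.card_filter,
      Finset.card_filter, Fin.sum_univ_castSucc]
    simp only [beq_iff_eq]

lemma sum_latticePaths {M : Type*} [AddCommMonoid M] (d : ℕ) (m : ℕ → ℕ) (f : List ℕ → M) :
    ∑ p ∈ latticePaths d m, f (reversedSteps p) = ∑ w ∈ words d m, f w := by
  refine Finset.sum_bij (fun p _ => reversedSteps p) ?_ ?_ ?_ fun _ _ => rfl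
  · intro p hp
    rw [mem_latticePaths] at hp
    rw [mem_words]
    refine ⟨fun a ha => ?_, fun i hi => by rw [count_reversedSteps, hp.2 i hi]⟩
    obtain ⟨s, rfl⟩ := mem_reversedSteps.1 ha
    exact hp.1 s
  · exact fun p _ p' _ h => reversedSteps_injective h
  · intro w hw
    have hlen := length_of_mem_words hw
    rw [← List.length_reverse] at hlen
    have hrev : reversedSteps (fun s => w.reverse.get (s.cast hlen.symm)) = w := by
      rw [reversedSteps, ← List.ofFn_congr hlen, List.ofFn_get, List.reverse_reverse]
    refine ⟨_, ?_, hrev⟩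
    rw [mem_words] at hw
    rw [mem_latticePaths]
    refine ⟨fun s => ?_, fun i hi => ?_⟩
    · apply hw.1
      rw [← List.mem_reverse]
      exact List.get_mem _ _
    · rw [← count_reversedSteps, hrev, hw.2 i hi]

/-- The partition `π_{a,b}` of a lattice path, in terms of its reversed word. -/
def wordPartition (a b : ℕ) : List ℕ → List ℕ
  | [] => []
  | x :: w => wordPartition a b w ++ if x = b then [w.count a] else []

lemma partition_eq {N : ℕ} (p : Fin N → ℕ) (a b : ℕ) :
    partition p a b = wordPartition a b (reversedSteps p) := by
  induction N with
  | zero => simp [partition, reversedSteps, wordPartition]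
  | succ N ih =>
    rw [reversedSteps_succ, wordPartition, ← ih, count_reversedSteps, partition, partition,
      List.finRange_succ_last, List.filter_append, List.map_append, List.filter_map, List.map_map]
    congr 1
    · refine List.map_congr_left fun s _ => ?_
      simp [Finset.card_filter, -Finset.sum_boole, Fin.sum_univ_castSucc,
        (Fin.castSucc_lt_last s).not_gt]
    · by_cases h : p (Fin.last N) = b
      · simp [h, stepCount, Finset.card_filter, -Finset.sum_boole, Fin.sum_univ_castSucc,
          Fin.castSucc_lt_last]
      · simp [h]

lemma length_wordPartition (a b : ℕ) (w : List ℕ) :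
    (wordPartition a b w).length = w.count b := by
  induction w with
  | nil => rfl
  | cons x w ih =>
    rw [wordPartition, List.length_append, ih, List.count_cons]
    by_cases h : x = b <;> simp [h]

lemma wordPartition_prefix (a b : ℕ) {s w : List ℕ} (h : s <:+ w) :
    wordPartition a b s <+: wordPartition a b w := by
  induction w with
  | nil => rw [List.suffix_nil.1 h]
  | cons x w ih =>
    rcases List.suffix_cons_iff.1 h with rfl | h
    · exact List.prefix_rfl
    · exact (ih h).trans (List.prefix_append _ _)

/-- The parts do not exceed the total number of steps `a`. -/
lemma le_count_of_mem_wordPartition {a b t : ℕ} {w : List ℕ} (h : t ∈ wordPartition a b w) :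
    t ≤ w.count a := by
  induction w with
  | nil => simp [wordPartition] at h
  | cons x w ih =>
    have hle : w.count a ≤ (x :: w).count a := (List.sublist_cons_self x w).count_le a
    rw [wordPartition, List.mem_append] at h
    rcases h with h | h
    · exact (ih h).trans hle
    · split_ifs at h
      · rw [List.mem_singleton.1 h]
        exact hle
      · simp at h

lemma count_wordPartition_cons (a b t x : ℕ) (w : List ℕ) :
    (wordPartition a b (x :: w)).count t =
      (wordPartition a b w).count t + if x = b ∧ w.count a = t then 1 else 0 := by
  rw [wordPartition, List.count_append]
  by_cases h : x = b <;> by_cases h' : w.count a = t <;> simp [h, h']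

/-- A part of `π_{a,b}` is determined by the portion of the path before the corresponding step. -/
lemma part_of_suffix {N : ℕ} (p : Fin N → ℕ) (a b : ℕ) {s : List ℕ}
    (h : (b :: s) <:+ reversedSteps p) : part p a b (s.count b + 1) = s.count a := by
  obtain ⟨l, hl⟩ := wordPartition_prefix a b h
  rw [part, partition_eq, ← hl, wordPartition, if_pos rfl, Nat.add_sub_cancel,
    ← length_wordPartition a b s]
  simp

/-- `S_t` counts the chains `1, …, d` in the portion of the path up to its `t`-th step `e_d`. -/
lemma partialVolume_of_suffix {N : ℕ} (p : Fin N → ℕ) (d : ℕ) {s : List ℕ}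
    (h : s <:+ reversedSteps p) :
    partialVolume p d (s.count d) = chainCount s d := by
  induction d generalizing s with
  | zero => rw [partialVolume, chainCount_zero]
  | succ d ihd =>
    induction s with
    | nil => cases d <;> simp [partialVolume, chainCount_nil_succ]
    | cons x s ihs =>
      have hs : s <:+ reversedSteps p := (List.suffix_cons x s).trans h
      rw [chainCount_cons_succ, ← ihs hs, List.count_cons]
      by_cases hx : x = d + 1
      · subst hx
        rw [if_pos (by simp), if_pos rfl, ← ihd hs]
        cases d with
        | zero => simp only [partialVolume]
        | succ d =>
          rw [partialVolume, partialVolume, Finset.sum_Icc_succ_top (by omega),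
            part_of_suffix p _ _ h]
      · rw [if_neg (by simpa using hx), if_neg hx, add_zero, add_zero]

/-! ### The coefficients of the series -/

/-- The suffixes of a word grouped by the number of letters `d` they contain: there is one more
suffix with `t` letters `d` than there are other letters preceded by `t` letters `d`. -/
lemma prod_tails_count {M : Type*} [CommMonoid M] (d : ℕ) (h : ℕ → M) (w : List ℕ)
    (hw : ∀ a ∈ w, a ∈ Finset.Icc 1 d) :
    (w.tails.map fun s => h (s.count d)).prod =
      ∏ t ∈ Finset.range (w.count d + 1),
        h t ^ (1 + ∑ l ∈ Finset.Icc 1 (d - 1), (wordPartition d l w).count t) := by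
  induction w with
  | nil => simp [wordPartition]
  | cons x w ih =>
    have hx := hw x (by simp)
    simp only [Finset.mem_Icc] at hx
    rw [List.tails_cons, List.map_cons, List.prod_cons, ih fun a ha => hw a (by simp [ha])]
    simp only [count_wordPartition_cons]
    by_cases hxd : x = d
    · subst hxd
      have hne : ∀ t, ∀ l ∈ Finset.Icc 1 (x - 1),
          (wordPartition x l w).count t + (if x = l ∧ w.count x = t then 1 else 0) =
            (wordPartition x l w).count t := by
        intro t l hl
        simp only [Finset.mem_Icc] at hl
        rw [if_neg (by omega), add_zero]
      simp only [Finset.sum_congr rfl (hne _)]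
      rw [List.count_cons_self, Finset.prod_range_succ _ (w.count x + 1), mul_comm]
      congr 1
      rw [Finset.sum_eq_zero, add_zero, pow_one]
      intro l _
      rw [List.count_eq_zero]
      intro hmem
      have := le_count_of_mem_wordPartition hmem
      omega
    · have hsum : ∀ t, ∑ l ∈ Finset.Icc 1 (d - 1),
          ((wordPartition d l w).count t + if x = l ∧ w.count d = t then 1 else 0) =
            ∑ l ∈ Finset.Icc 1 (d - 1), (wordPartition d l w).count t +
              if w.count d = t then 1 else 0 := by
        intro t
        rw [Finset.sum_add_distrib]
        simp only [ite_and]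
        rw [Finset.sum_ite_eq, if_pos (by simp only [Finset.mem_Icc]; omega)]
      simp only [hsum, ← add_assoc, pow_add _ _ (ite _ _ _), Finset.prod_mul_distrib]
      rw [List.count_cons_of_ne hxd, mul_comm]
      congr 1
      simp [pow_ite]

lemma inv_pow_powerSeries {K : Type*} [Field K] (f : PowerSeries K) (n : ℕ) :
    (f ^ n)⁻¹ = f⁻¹ ^ n := by
  induction n with
  | zero => simp
  | succ n ih => rw [pow_succ, PowerSeries.mul_inv_rev, ih, pow_succ']

/-- The coefficient of `u ^ m_{d+1}` in the series is the chain enumerator of the words with letter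
counts `m_1, …, m_{d+1}`. -/
lemma coeff_pathSeries (d : ℕ) (m : ℕ → ℕ) (q : ℂ) :
    PowerSeries.coeff (m (d + 1)) (pathSeries d m q) =
      ∑ w ∈ words (d + 1) m, q ^ chainCount w (d + 1) := by
  have key : ∀ p ∈ latticePaths d m, ∏ t ∈ Finset.range (side m d + 1),
      ((1 - PowerSeries.X * PowerSeries.C (q ^ partialVolume p d t)) ^
        (1 + ∑ l ∈ Finset.Icc 1 (d - 1), multiplicity p d l t))⁻¹ =
      PowerSeries.mk fun n => ∑ w ∈ insertions (d + 1) (reversedSteps p) n,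
        q ^ chainCount w (d + 1) := by
    intro p hp
    have hp' := (mem_latticePaths d m p).1 hp
    have hmem : ∀ a ∈ reversedSteps p, a ∈ Finset.Icc 1 d := by
      intro a ha
      obtain ⟨s, rfl⟩ := mem_reversedSteps.1 ha
      exact hp'.1 s
    have htails : (reversedSteps p).tails.map (fun s =>
        (1 - PowerSeries.X * PowerSeries.C (q ^ chainCount s d))⁻¹) =
        (reversedSteps p).tails.map (fun s =>
          (1 - PowerSeries.X * PowerSeries.C (q ^ partialVolume p d (s.count d)))⁻¹) := by
      refine List.map_congr_left fun s hs => ?_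
      rw [partialVolume_of_suffix p d ((List.mem_tails _ _).1 hs)]
    rw [mk_sum_insertions q d _ fun a ha => (Finset.mem_Icc.1 (hmem a ha)).2, htails,
      prod_tails_count d
        (fun t => (1 - PowerSeries.X * PowerSeries.C (q ^ partialVolume p d t))⁻¹) _ hmem]
    have hside : side m d = (reversedSteps p).count d := by
      rw [count_reversedSteps]
      cases d with
      | zero =>
        rw [side, stepCount, eq_comm, Finset.card_eq_zero, Finset.filter_eq_empty_iff]
        intro s _ h
        have := hp'.1 s
        simp at this
      | succ d => exact (hp'.2 (d + 1) (by simp)).symm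
    rw [hside]
    refine Finset.prod_congr rfl fun t _ => ?_
    rw [inv_pow_powerSeries]
    simp only [multiplicity, partition_eq]
  rw [pathSeries, Finset.sum_congr rfl key, map_sum, sum_words_succ, ← sum_latticePaths]
  simp only [PowerSeries.coeff_mk]

/-! ### Paths and lenses -/

open Classical in
lemma pointCount_eq_card (X : Finset ℝ) (B : Set ℝ) :
    pointCount X B = (X.filter (· ∈ B)).card := by
  rw [pointCount, ← Set.ncard_coe_finset, Finset.coe_filter]
  rfl

open Classical in
/-- The number of walks with `j` edges from the vertex `0` to the vertex `x`. -/
noncomputable def walkCount (r : ℝ) (X : Finset ℝ) : ℕ → ℝ → ℕ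
  | 0, x => if x = 0 then 1 else 0
  | j + 1, x => ∑ u ∈ (vertices X).filter (fun u => u ≠ x ∧ |u - x| < r), walkCount r X j u

open Classical in
lemma adjMatrix_pow_eq_walkCount (r : ℝ) (X : Finset ℝ) (j : ℕ)
    (v : {x : ℝ // x ∈ vertices X}) :
    ((graph r X).adjMatrix ℕ ^ j) ⟨0, zero_mem_vertices X⟩ v = walkCount r X j v := by
  induction j generalizing v with
  | zero =>
    rw [pow_zero, Matrix.one_apply, walkCount]
    simp only [Subtype.ext_iff, eq_comm]
  | succ j ih =>
    rw [pow_succ, Matrix.mul_apply, walkCount, Finset.sum_filter,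
      ← Finset.sum_coe_sort (vertices X)]
    refine Finset.sum_congr rfl fun u _ => ?_
    rw [ih, SimpleGraph.adjMatrix_apply, mul_ite, mul_one, mul_zero]
    refine if_congr ?_ rfl rfl
    simp only [graph, ne_eq, Subtype.ext_iff]

/-- The end points of a walk with `l` edges are at most `l r` apart. -/
lemma abs_sub_le_of_walk {r : ℝ} {X : Finset ℝ} {u v : {x : ℝ // x ∈ vertices X}}
    (p : (graph r X).Walk u v) : |(u : ℝ) - v| ≤ p.length * r := by
  induction p with
  | nil => simp
  | @cons u v w h p ih =>
    have h1 : |(u : ℝ) - v| < r := h.2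
    have h2 := abs_sub_le (u : ℝ) v w
    rw [SimpleGraph.Walk.length_cons]
    push_cast
    linarith

/-- For `(k - 1) r < 1` the graph distance from `0` to `1` is at least `k`, so that a walk with `k`
edges from `0` to `1` repeats no vertex. -/
lemma hopCount_eq_walkCount {k : ℕ} {r : ℝ} (hr0 : 0 < r) (hr' : ((k : ℝ) - 1) * r < 1)
    (X : Finset ℝ) : hopCount k r X = walkCount r X k 1 := by
  classical
  have hlen : ∀ p : (graph r X).Walk ⟨0, zero_mem_vertices X⟩ ⟨1, one_mem_vertices X⟩,
      k ≤ p.length := by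
    intro p
    have h := abs_sub_le_of_walk p
    by_contra! hlt
    have h2 : (p.length : ℝ) ≤ k - 1 := by
      rw [le_sub_iff_add_le]
      exact_mod_cast hlt
    have h3 := mul_le_mul_of_nonneg_right h2 hr0.le
    norm_num at h
    linarith
  have hpath : ∀ p : (graph r X).Walk ⟨0, zero_mem_vertices X⟩ ⟨1, one_mem_vertices X⟩,
      p.length = k → p.IsPath := by
    intro p hp
    apply p.isPath_of_length_eq_dist
    obtain ⟨p', hp'⟩ := p.reachable.exists_walk_length_eq_dist
    refine le_antisymm ?_ (SimpleGraph.dist_le p)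
    rw [hp, ← hp']
    exact hlen p'
  have h := adjMatrix_pow_eq_walkCount r X k ⟨1, one_mem_vertices X⟩
  rw [SimpleGraph.adjMatrix_pow_apply_eq_card_walk] at h
  rw [hopCount, ← h, Nat.cast_id, ← Nat.card_eq_fintype_card]
  exact Nat.card_congr (Equiv.subtypeEquivRight fun p =>
    ⟨fun hp => hp.2, fun hp => ⟨hpath p hp, hp⟩⟩)

lemma abs_lt_of_walkCount_ne_zero {r : ℝ} {X : Finset ℝ} {j : ℕ} {x : ℝ} (hj : 1 ≤ j)
    (h : walkCount r X j x ≠ 0) : |x| < j * r := by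
  classical
  induction j, hj using Nat.le_induction generalizing x with
  | base =>
    rw [walkCount] at h
    obtain ⟨u, hu, hu'⟩ := Finset.exists_ne_zero_of_sum_ne_zero h
    rw [Finset.mem_filter] at hu
    have h0 : u = 0 := by by_contra h0; simp [walkCount, h0] at hu'
    have := hu.2.2
    rw [h0, zero_sub, abs_neg] at this
    simpa using this
  | succ j hj ih =>
    rw [walkCount] at h
    obtain ⟨u, hu, hu'⟩ := Finset.exists_ne_zero_of_sum_ne_zero h
    rw [Finset.mem_filter] at hu
    have h1 := ih hu'
    have h2 := hu.2.2
    have h3 := abs_sub_abs_le_abs_sub x u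
    rw [abs_sub_comm] at h3
    push_cast
    linarith

/-- The left end point of the lens `L_j`. -/
noncomputable def lensStart (k : ℕ) (r : ℝ) (j : ℕ) : ℝ := 1 - ((k : ℝ) - j) * r

lemma lensStart_succ (k : ℕ) (r : ℝ) (j : ℕ) : lensStart k r (j + 1) = lensStart k r j + r := by
  rw [lensStart, lensStart]
  push_cast
  ring

/-- The relative position of `x` in the lens `L_j`, between `0` and `1` for points of the lens. -/
noncomputable def lensCoord (k : ℕ) (r : ℝ) (j : ℕ) (x : ℝ) : ℝ :=
  (x - lensStart k r j) / (k * r - 1)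

/-- The index of the subinterval containing `x` when the lens `L_j` is cut into `n` intervals of the
same length. -/
noncomputable def column (k : ℕ) (r : ℝ) (n j : ℕ) (x : ℝ) : ℕ := ⌊n * lensCoord k r j x⌋₊

/-- The `i`-th of the `n` subintervals of the lens `L_j`. -/
def cell (k : ℕ) (r : ℝ) (n j i : ℕ) : Set ℝ := {x | x ∈ lens k r j ∧ column k r n j x = i}

lemma mem_cell {k : ℕ} {r : ℝ} {n j i : ℕ} {x : ℝ} :
    x ∈ cell k r n j i ↔ x ∈ lens k r j ∧ column k r n j x = i := Iff.rfl

lemma radius_pos {k : ℕ} {r : ℝ} (hr : 1 < k * r)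
    (hr' : ((k : ℝ) - 1) * r < 1) : 0 < r := by linarith

lemma lens_eq {k : ℕ} {r : ℝ} (hr : 1 < k * r)
    (hr' : ((k : ℝ) - 1) * r < 1) {j : ℕ} (hj : j ∈ Finset.Icc 1 (k - 1)) :
    lens k r j = Set.Ioo (lensStart k r j) (j * r) := by
  have hr0 := radius_pos hr hr'
  rw [Finset.mem_Icc] at hj
  have hj1 : (1 : ℝ) ≤ j := by exact_mod_cast hj.1
  have hjk : (j : ℝ) + 1 ≤ k := by exact_mod_cast (by omega : j + 1 ≤ k)
  have h1 : (j : ℝ) * r < 1 := lt_of_le_of_lt (mul_le_mul_of_nonneg_right (by linarith) hr0.le) hr'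
  have h2 : ((k : ℝ) - j) * r < 1 :=
    lt_of_le_of_lt (mul_le_mul_of_nonneg_right (by linarith) hr0.le) hr'
  ext x
  simp only [lens, lensStart, Set.mem_inter_iff, Metric.mem_ball, Real.dist_eq, abs_lt,
    Set.mem_Ioo, sub_zero]
  constructor
  · rintro ⟨⟨_, _⟩, _, _⟩
    constructor <;> linarith
  · rintro ⟨_, _⟩
    refine ⟨⟨?_, ?_⟩, ?_, ?_⟩ <;> linarith

lemma lens_subset_Ioo {k : ℕ} {r : ℝ} (hr : 1 < k * r)
    (hr' : ((k : ℝ) - 1) * r < 1) {j : ℕ} (hj : j ∈ Finset.Icc 1 (k - 1)) :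
    lens k r j ⊆ Set.Ioo 0 1 := by
  have hr0 := radius_pos hr hr'
  rw [lens_eq hr hr' hj]
  rw [Finset.mem_Icc] at hj
  have hj1 : (1 : ℝ) ≤ j := by exact_mod_cast hj.1
  have hjk : (j : ℝ) + 1 ≤ k := by exact_mod_cast (by omega : j + 1 ≤ k)
  refine Set.Ioo_subset_Ioo ?_ ?_
  · have : ((k : ℝ) - j) * r < 1 :=
      lt_of_le_of_lt (mul_le_mul_of_nonneg_right (by linarith) hr0.le) hr'
    rw [lensStart]
    linarith
  · exact (lt_of_le_of_lt (mul_le_mul_of_nonneg_right (by linarith) hr0.le) hr').le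

/-- The lenses are disjoint and ordered from left to right. -/
lemma mul_lt_lensStart_succ {k : ℕ} {r : ℝ} (hr' : ((k : ℝ) - 1) * r < 1) (j : ℕ) :
    j * r < lensStart k r (j + 1) := by
  rw [lensStart]
  push_cast
  linarith

lemma lensCoord_le_iff {k : ℕ} {r : ℝ} (hr : 1 < k * r) {i j : ℕ} {x y : ℝ} :
    lensCoord k r i x ≤ lensCoord k r j y ↔ x - lensStart k r i ≤ y - lensStart k r j := by
  rw [lensCoord, lensCoord, div_le_div_iff_of_pos_right (by linarith)]

lemma column_le_column {k : ℕ} {r : ℝ} (hr : 1 < k * r) {n i j : ℕ} {x y : ℝ}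
    (h : x - lensStart k r i ≤ y - lensStart k r j) :
    column k r n i x ≤ column k r n j y :=
  Nat.floor_le_floor (mul_le_mul_of_nonneg_left ((lensCoord_le_iff hr).2 h) (by positivity))

lemma lensCoord_mem_Ioo {k : ℕ} {r : ℝ} (hr : 1 < k * r)
    (hr' : ((k : ℝ) - 1) * r < 1) {j : ℕ} (hj : j ∈ Finset.Icc 1 (k - 1)) {x : ℝ}
    (hx : x ∈ lens k r j) :
    lensCoord k r j x ∈ Set.Ioo 0 1 := by
  rw [lens_eq hr hr' hj] at hx
  obtain ⟨h1, h2⟩ := hx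
  have : 0 < k * r - 1 := by linarith
  refine ⟨div_pos (by linarith) this, ?_⟩
  rw [lensCoord, div_lt_one this]
  rw [lensStart] at h1 ⊢
  linarith

lemma column_lt {k : ℕ} {r : ℝ} (hr : 1 < k * r)
    (hr' : ((k : ℝ) - 1) * r < 1) {n j : ℕ} (hn : 0 < n) (hj : j ∈ Finset.Icc 1 (k - 1)) {x : ℝ}
    (hx : x ∈ lens k r j) : column k r n j x < n := by
  obtain ⟨h1, h2⟩ := lensCoord_mem_Ioo hr hr' hj hx
  have hn' : (0 : ℝ) < n := by exact_mod_cast hn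
  rw [column, Nat.floor_lt (by positivity)]
  nlinarith

open Classical in
/-- The last but one vertex of a walk of length `j + 1` from `0` to a point beyond the lens `L_j` is
a point of this lens. -/
lemma walkCount_succ {k : ℕ} {r : ℝ} (hr : 1 < k * r)
    (hr' : ((k : ℝ) - 1) * r < 1) {X : Finset ℝ} {j : ℕ}
    (hj : j ∈ Finset.Icc 1 (k - 1)) {x : ℝ} (hx : lensStart k r (j + 1) ≤ x) :
    walkCount r X (j + 1) x =
      ∑ u ∈ X.filter (fun u => u ∈ lens k r j ∧ |u - x| < r), walkCount r X j u := by
  have hr0 := radius_pos hr hr'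
  rw [walkCount]
  symm
  refine Finset.sum_subset ?_ ?_
  · intro u hu
    rw [Finset.mem_filter] at hu ⊢
    obtain ⟨huX, hul, hux⟩ := hu
    rw [lens_eq hr hr' hj] at hul
    refine ⟨by simp [vertices, huX], ?_, hux⟩
    have := mul_lt_lensStart_succ hr' j
    have := hul.2
    exact ne_of_lt (by linarith)
  · intro u hu hu'
    by_contra hne
    rw [Finset.mem_filter] at hu
    apply hu'
    obtain ⟨huV, -, hux⟩ := hu
    have hlt := abs_lt_of_walkCount_ne_zero (Finset.mem_Icc.1 hj).1 hne
    have hul : u ∈ lens k r j := by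
      rw [lens_eq hr hr' hj]
      rw [lensStart_succ] at hx
      refine ⟨?_, lt_of_le_of_lt (le_abs_self u) hlt⟩
      linarith [(abs_lt.1 hux).1]
    have hu01 := lens_subset_Ioo hr hr' hj hul
    rw [Finset.mem_filter]
    refine ⟨?_, hul, hux⟩
    simpa [vertices, hu01.1.ne', hu01.2.ne] using huV

/-- If every column contains at most one point then the number of paths is determined by the word
`s` which records the lens (or `0`) of the point in each column: two points of consecutive lenses
are joined if and only if the one of the left lens lies in a column of larger index. -/
lemma hopCount_eq_chainCount {k : ℕ} {r : ℝ} (hr : 1 < k * r)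
    (hr' : ((k : ℝ) - 1) * r < 1) (hk : 2 ≤ k) {X : Finset ℝ}
    {s : List ℕ} (hs : 0 < s.length)
    (hcell : ∀ j ∈ Finset.Icc 1 (k - 1), ∀ i < s.length,
      pointCount X (cell k r s.length j i) = if s.getD i 0 = j then 1 else 0) :
    hopCount k r X = chainCount s (k - 1) := by
  classical
  have hr0 := radius_pos hr hr'
  set n := s.length with hn
  -- The letter at the column of a point is its lens; in particular, points of different lenses lie
  -- in different columns.
  have hcol : ∀ j ∈ Finset.Icc 1 (k - 1), ∀ x ∈ X, x ∈ lens k r j →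
      s.getD (column k r n j x) 0 = j := by
    intro j hj x hxX hx
    by_contra hne
    have h := hcell j hj _ (column_lt hr hr' hs hj hx)
    rw [if_neg hne, pointCount_eq_card, Finset.card_eq_zero] at h
    have hmem : x ∈ X.filter (· ∈ cell k r n j (column k r n j x)) :=
      Finset.mem_filter.2 ⟨hxX, hx, rfl⟩
    rw [h] at hmem
    simp at hmem
  -- The walks to a point arrive from the points of the previous lens in columns further right.
  have hrec : ∀ j ∈ Finset.Icc 1 (k - 1), j + 1 ∈ Finset.Icc 1 (k - 1) → ∀ x ∈ X,
      x ∈ lens k r (j + 1) → walkCount r X (j + 1) x =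
        ∑ u ∈ X.filter (fun u => u ∈ lens k r j ∧
          column k r n (j + 1) x + 1 ≤ column k r n j u), walkCount r X j u := by
    intro j hj hj' x hxX hx
    have hx' := hx
    rw [lens_eq hr hr' hj'] at hx'
    rw [walkCount_succ hr hr' hj hx'.1.le]
    congr 1
    ext u
    simp only [Finset.mem_filter]
    refine and_congr_right fun huX => and_congr_right fun hu => ?_
    have hu' := hu
    rw [lens_eq hr hr' hj] at hu'
    have hux : u < x := by linarith [mul_lt_lensStart_succ hr' j, hu'.2, hx'.1]
    rw [abs_sub_comm, abs_of_pos (by linarith)]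
    have hstart := lensStart_succ k r j
    constructor
    · intro h
      refine lt_of_le_of_ne (column_le_column hr (by linarith)) fun heq => ?_
      have h1 := hcol j hj u huX hu
      have h2 := hcol (j + 1) hj' x hxX hx
      rw [heq, h1] at h2
      omega
    · intro h
      by_contra! hle
      have := column_le_column (n := n) (i := j) (j := j + 1) (x := u) (y := x) hr (by linarith)
      omega
  have hone : ∀ x ∈ X, x ∈ lens k r 1 → walkCount r X 1 x = 1 := by
    intro x hxX hx
    have h1 : 1 ∈ Finset.Icc 1 (k - 1) := by simp only [Finset.mem_Icc]; omega
    have hx0 := lens_subset_Ioo hr hr' h1 hx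
    rw [lens_eq hr hr' h1] at hx
    have hxr : x < r := by simpa using hx.2
    rw [walkCount, Finset.sum_filter, Finset.sum_eq_single 0]
    · simp [walkCount, hx0.1.ne, abs_of_pos hx0.1, hxr]
    · intro u _ hu
      simp [walkCount, hu]
    · exact fun h => absurd (zero_mem_vertices X) h
  -- Adding the columns from right to left is the recursion which defines `chainCount`.
  have hsum : ∀ l c, c + l = n → ∀ j ∈ Finset.Icc 1 (k - 1),
      ∑ x ∈ X.filter (fun x => x ∈ lens k r j ∧ c ≤ column k r n j x), walkCount r X j x =
        chainCount (s.drop c) j := by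
    intro l
    induction l with
    | zero =>
      intro c hc j hj
      have hj' := (Finset.mem_Icc.1 hj).1
      rw [List.drop_of_length_le (by omega), Finset.filter_false_of_mem, Finset.sum_empty]
      · obtain ⟨j, rfl⟩ : ∃ i, j = i + 1 := ⟨j - 1, by omega⟩
        rfl
      · rintro x - ⟨hx, hx'⟩
        have := column_lt hr hr' hs hj hx
        omega
    | succ l ih =>
      intro c hc j hj
      have hcn : c < s.length := by omega
      have hval : ∀ x ∈ X.filter (· ∈ cell k r n j c), walkCount r X j x =
          chainCount (s.drop (c + 1)) (j - 1) := by
        intro x hx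
        rw [Finset.mem_filter] at hx
        obtain ⟨hxX, hxl, rfl⟩ := hx
        rcases Nat.lt_or_ge 1 j with h1 | h1
        · obtain ⟨j, rfl⟩ : ∃ i, j = i + 1 := ⟨j - 1, by omega⟩
          have hj' : j ∈ Finset.Icc 1 (k - 1) := by
            simp only [Finset.mem_Icc] at hj ⊢
            omega
          rw [hrec j hj' hj x hxX hxl, ih _ (by omega) j hj', Nat.add_sub_cancel]
        · obtain rfl : j = 1 := le_antisymm h1 (Finset.mem_Icc.1 hj).1
          rw [hone x hxX hxl, chainCount_zero]
      have hsplit : X.filter (fun x => x ∈ lens k r j ∧ c ≤ column k r n j x) =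
          X.filter (fun x => x ∈ lens k r j ∧ c + 1 ≤ column k r n j x) ∪
            X.filter (· ∈ cell k r n j c) := by
        ext x
        simp only [Finset.mem_filter, Finset.mem_union, mem_cell]
        constructor
        · rintro ⟨h1, h2, h3⟩
          rcases h3.eq_or_lt with h3 | h3
          · exact Or.inr ⟨h1, h2, h3.symm⟩
          · exact Or.inl ⟨h1, h2, h3⟩
        · rintro (⟨h1, h2, h3⟩ | ⟨h1, h2, h3⟩)
          · exact ⟨h1, h2, by omega⟩
          · exact ⟨h1, h2, by omega⟩
      rw [hsplit, Finset.sum_union, ih (c + 1) (by omega) j hj, Finset.sum_congr rfl hval,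
        Finset.sum_const, ← pointCount_eq_card, hcell j hj c hcn, List.drop_eq_getElem_cons hcn,
        List.getD_eq_getElem _ _ hcn]
      · obtain ⟨j, rfl⟩ : ∃ i, j = i + 1 := ⟨j - 1, by have := (Finset.mem_Icc.1 hj).1; omega⟩
        rw [chainCount_cons_succ, Nat.add_sub_cancel]
        simp
      · rw [Finset.disjoint_left]
        intro x hx hx'
        rw [Finset.mem_filter] at hx hx'
        have := hx'.2.2
        omega
  have hk1 : k - 1 ∈ Finset.Icc 1 (k - 1) := by simp only [Finset.mem_Icc]; omega
  have hcast : ((k - 1 : ℕ) : ℝ) = k - 1 := by rw [Nat.cast_sub (by omega), Nat.cast_one]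
  have hlast := walkCount_succ hr hr' (X := X) hk1 (x := 1)
    (by rw [lensStart_succ, lensStart, hcast]; linarith)
  rw [show k - 1 + 1 = k by omega] at hlast
  rw [hopCount_eq_walkCount hr0 hr', hlast, ← List.drop_zero (l := s), ← hsum n 0 (by omega) _ hk1]
  congr 1
  ext u
  simp only [Finset.mem_filter]
  refine and_congr_right fun huX => and_congr_right fun hu => ?_
  have hball := hu.2
  rw [Metric.mem_ball, Real.dist_eq, hcast] at hball
  simp only [zero_le, iff_true]
  linarith

/-! ### Words with empty columns -/

/-- The words of length `n` in the letters `0, …, d` in which the letter `i ≥ 1` occurs `m i` times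
(for `n ≥ m 1 + ⋯ + m d`). The letter `0` stands for an empty column. -/
def paddedWords (d : ℕ) (m : ℕ → ℕ) (n : ℕ) : Finset (List ℕ) :=
  (words d m).biUnion fun w => insertions 0 w (n - ∑ i ∈ Finset.Icc 1 d, m i)

lemma chainCount_of_mem_insertions_zero {d j n : ℕ} {m : ℕ → ℕ} {w s : List ℕ}
    (hw : w ∈ words d m) (hs : s ∈ insertions 0 w n) : chainCount s j = chainCount w j := by
  rw [mem_insertions (not_mem_of_mem_words hw (Or.inl rfl))] at hs
  rw [← hs.1, chainCount_filter _ _ _ (Or.inl rfl)]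

lemma exists_word_of_mem_paddedWords {d n : ℕ} {m : ℕ → ℕ} {s : List ℕ}
    (hs : s ∈ paddedWords d m n) : ∃ w ∈ words d m, ∀ j, chainCount s j = chainCount w j := by
  obtain ⟨w, hw, hs⟩ := Finset.mem_biUnion.1 hs
  exact ⟨w, hw, fun _ => chainCount_of_mem_insertions_zero hw hs⟩

lemma length_eq_count_add_length_filter (s : List ℕ) (z : ℕ) :
    s.length = s.count z + (s.filter (· ≠ z)).length := by
  rw [List.length_eq_countP_add_countP (· == z), List.count, ← List.countP_eq_length_filter]
  simp

lemma mem_paddedWords {d n : ℕ} {m : ℕ → ℕ} (hn : ∑ i ∈ Finset.Icc 1 d, m i ≤ n) {s : List ℕ} :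
    s ∈ paddedWords d m n ↔
      (∀ a ∈ s, a ≤ d) ∧ (∀ i ∈ Finset.Icc 1 d, s.count i = m i) ∧ s.length = n := by
  have hlen := length_eq_count_add_length_filter s 0
  have hcount : ∀ i ∈ Finset.Icc 1 d, (s.filter (· ≠ 0)).count i = s.count i := by
    intro i hi
    rw [Finset.mem_Icc] at hi
    exact List.count_filter (by simp; omega)
  rw [paddedWords, Finset.mem_biUnion]
  constructor
  · rintro ⟨w, hw, hs⟩
    rw [mem_insertions (not_mem_of_mem_words hw (Or.inl rfl))] at hs
    obtain ⟨rfl, hs⟩ := hs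
    refine ⟨fun a ha => ?_, fun i hi => ?_, ?_⟩
    · by_cases h : a = 0
      · omega
      · exact (Finset.mem_Icc.1 ((mem_words.1 hw).1 a (List.mem_filter.2 ⟨ha, by simpa using h⟩))).2
    · rw [← hcount i hi, (mem_words.1 hw).2 i hi]
    · rw [length_of_mem_words hw] at hlen
      omega
  · rintro ⟨h1, h2, h3⟩
    have hw : s.filter (· ≠ 0) ∈ words d m := by
      rw [mem_words]
      refine ⟨fun a ha => ?_, fun i hi => by rw [hcount i hi, h2 i hi]⟩
      rw [List.mem_filter] at ha
      have := h1 a ha.1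
      have : a ≠ 0 := by simpa using ha.2
      rw [Finset.mem_Icc]
      omega
    refine ⟨_, hw, (mem_insertions (not_mem_of_mem_words hw (Or.inl rfl))).2 ⟨rfl, ?_⟩⟩
    rw [length_of_mem_words hw] at hlen
    omega

/-- Every word is padded in the same number of ways. -/
lemma sum_paddedWords {d n : ℕ} {m : ℕ → ℕ} (hn : ∑ i ∈ Finset.Icc 1 d, m i ≤ n) (f : ℕ → ℂ) :
    ∑ s ∈ paddedWords d m n, f (chainCount s d) =
      (n.choose (∑ i ∈ Finset.Icc 1 d, m i) : ℂ) * ∑ w ∈ words d m, f (chainCount w d) := by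
  rw [paddedWords, Finset.sum_biUnion (pairwiseDisjoint_insertions m (Or.inl rfl) _),
    Finset.mul_sum]
  refine Finset.sum_congr rfl fun w hw => ?_
  rw [Finset.sum_congr rfl fun s hs => by rw [chainCount_of_mem_insertions_zero hw hs],
    Finset.sum_const, card_insertions _ (not_mem_of_mem_words hw (Or.inl rfl)),
    length_of_mem_words hw, Nat.sub_add_cancel hn, Nat.choose_symm hn, nsmul_eq_mul]

lemma count_eq_card_filter_range (s : List ℕ) (j : ℕ) :
    s.count j = ((Finset.range s.length).filter fun i => s.getD i 0 = j).card := by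
  rw [Finset.card_filter]
  induction s with
  | nil => simp
  | cons a s ih =>
    rw [List.length_cons, Finset.sum_range_succ', List.count_cons, ih]
    simp

/-! ### Cells and columns -/

/-- The union of the `i`-th cells of all lenses. -/
def columnSet (k : ℕ) (r : ℝ) (n i : ℕ) : Set ℝ := ⋃ j ∈ Finset.Icc 1 (k - 1), cell k r n j i

lemma pointCount_biUnion {ι : Type*} (X : Finset ℝ) (I : Finset ι) (B : ι → Set ℝ)
    (hB : (I : Set ι).PairwiseDisjoint B) :
    pointCount X (⋃ i ∈ I, B i) = ∑ i ∈ I, pointCount X (B i) := by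
  classical
  simp only [pointCount_eq_card]
  rw [← Finset.card_biUnion]
  · congr 1
    ext x
    simp only [Finset.mem_filter, Set.mem_iUnion, Finset.mem_biUnion]
    constructor
    · rintro ⟨h1, i, h2, h3⟩
      exact ⟨i, h2, h1, h3⟩
    · rintro ⟨i, h2, h1, h3⟩
      exact ⟨h1, i, h2, h3⟩
  · intro i hi j hj hij
    rw [Function.onFun, Finset.disjoint_left]
    intro x hx hx'
    exact Set.disjoint_left.1 (hB hi hj hij) (Finset.mem_filter.1 hx).2 (Finset.mem_filter.1 hx').2

lemma lens_eq_biUnion_cell {k : ℕ} {r : ℝ} (hr : 1 < k * r)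
    (hr' : ((k : ℝ) - 1) * r < 1) {n j : ℕ} (hn : 0 < n) (hj : j ∈ Finset.Icc 1 (k - 1)) :
    lens k r j = ⋃ i ∈ Finset.range n, cell k r n j i := by
  ext x
  simp only [Set.mem_iUnion, Finset.mem_range, mem_cell]
  constructor
  · intro hx
    exact ⟨_, column_lt hr hr' hn hj hx, hx, rfl⟩
  · rintro ⟨i, -, hx, -⟩
    exact hx

lemma disjoint_lens {k : ℕ} {r : ℝ} (hr : 1 < k * r)
    (hr' : ((k : ℝ) - 1) * r < 1) {i j : ℕ} (hi : i ∈ Finset.Icc 1 (k - 1))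
    (hj : j ∈ Finset.Icc 1 (k - 1)) (hij : i ≠ j) : Disjoint (lens k r i) (lens k r j) := by
  wlog h : i < j generalizing i j
  · exact (this hj hi hij.symm (by omega)).symm
  rw [lens_eq hr hr' hi, lens_eq hr hr' hj, Set.disjoint_left]
  rintro x ⟨-, h1⟩ ⟨h2, -⟩
  obtain ⟨j, rfl⟩ : ∃ l, j = l + 1 := ⟨j - 1, by omega⟩
  have h3 := mul_lt_lensStart_succ hr' j
  have h4 : (i : ℝ) * r ≤ j * r :=
    mul_le_mul_of_nonneg_right (by exact_mod_cast (by omega : i ≤ j)) (radius_pos hr hr').le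
  linarith

lemma disjoint_cell {k : ℕ} {r : ℝ} (hr : 1 < k * r) (hr' : ((k : ℝ) - 1) * r < 1) {n : ℕ}
    {x y : ℕ × ℕ} (hx : x.1 ∈ Finset.Icc 1 (k - 1)) (hy : y.1 ∈ Finset.Icc 1 (k - 1))
    (hxy : x ≠ y) : Disjoint (cell k r n x.1 x.2) (cell k r n y.1 y.2) := by
  by_cases h : x.1 = y.1
  · rw [Set.disjoint_left]
    rintro u hu hu'
    rw [mem_cell] at hu hu'
    rw [← h, hu.2] at hu'
    exact hxy (Prod.ext h hu'.2)
  · exact (disjoint_lens hr hr' hx hy h).mono (fun _ hu => hu.1) (fun _ hu => hu.1)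

/-- A cell is a half-open interval; the first one does not contain the left end point of the
lens. -/
lemma cell_eq {k : ℕ} {r : ℝ} (hr : 1 < k * r) (hr' : ((k : ℝ) - 1) * r < 1) {n j i : ℕ}
    (hi : i < n) (hj : j ∈ Finset.Icc 1 (k - 1)) :
    cell k r n j i = Set.Ico (lensStart k r j + i * ((k * r - 1) / n))
      (lensStart k r j + (i + 1) * ((k * r - 1) / n)) \ {lensStart k r j} := by
  have hn : (0 : ℝ) < n := by exact_mod_cast (by omega : 0 < n)
  have he : 0 < k * r - 1 := by linarith
  have hi' : (i : ℝ) + 1 ≤ n := by exact_mod_cast hi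
  have hend : (j : ℝ) * r = lensStart k r j + (k * r - 1) := by rw [lensStart]; ring
  ext x
  rw [mem_cell, lens_eq hr hr' hj, hend, Set.mem_Ioo, Set.mem_sdiff, Set.mem_Ico,
    Set.mem_singleton_iff]
  have hscale : ∀ c : ℝ, c * ((k * r - 1) / n) = (c / n) * (k * r - 1) := fun c => by ring
  have hiff : ∀ h : lensStart k r j < x, column k r n j x = i ↔
      (lensStart k r j + i * ((k * r - 1) / n) ≤ x ∧
        x < lensStart k r j + (i + 1) * ((k * r - 1) / n)) := by
    intro h
    have h0 : 0 ≤ n * lensCoord k r j x :=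
      mul_nonneg hn.le (div_nonneg (by linarith) he.le)
    rw [column, Nat.floor_eq_iff h0, lensCoord, hscale, hscale, ← le_sub_iff_add_le',
      ← sub_lt_iff_lt_add' (a := x), ← le_div_iff₀ he, ← div_lt_iff₀ he, div_le_iff₀' hn,
      lt_div_iff₀' hn]
  constructor
  · rintro ⟨⟨h1, h2⟩, h3⟩
    exact ⟨(hiff h1).1 h3, h1.ne'⟩
  · rintro ⟨⟨h1, h2⟩, h3⟩
    have h4 : lensStart k r j < x :=
      lt_of_le_of_ne (le_trans (le_add_of_nonneg_right (by positivity)) h1) (Ne.symm h3)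
    refine ⟨⟨h4, h2.trans_le ?_⟩, (hiff h4).2 ⟨h1, h2⟩⟩
    rw [hscale]
    have : ((i : ℝ) + 1) / n ≤ 1 := (div_le_one hn).2 hi'
    nlinarith

lemma measurableSet_cell {k : ℕ} {r : ℝ} (hr : 1 < k * r) (hr' : ((k : ℝ) - 1) * r < 1)
    {n j i : ℕ} (hi : i < n) (hj : j ∈ Finset.Icc 1 (k - 1)) : MeasurableSet (cell k r n j i) := by
  rw [cell_eq hr hr' hi hj]
  exact measurableSet_Ico.diff (measurableSet_singleton _)

lemma volume_cell {k : ℕ} {r : ℝ} (hr : 1 < k * r) (hr' : ((k : ℝ) - 1) * r < 1)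
    {n j i : ℕ} (hi : i < n) (hj : j ∈ Finset.Icc 1 (k - 1)) :
    volume (cell k r n j i) = ENNReal.ofReal ((k * r - 1) / n) := by
  rw [cell_eq hr hr' hi hj, measure_sdiff_null (by simp), Real.volume_Ico]
  congr 1
  ring

lemma cell_subset_Icc {k : ℕ} {r : ℝ} (hr : 1 < k * r) (hr' : ((k : ℝ) - 1) * r < 1)
    {n j i : ℕ} (hj : j ∈ Finset.Icc 1 (k - 1)) : cell k r n j i ⊆ Set.Icc 0 1 :=
  fun _ hx => Set.Ioo_subset_Icc_self (lens_subset_Ioo hr hr' hj hx.1)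

lemma measurableSet_columnSet {k : ℕ} {r : ℝ} (hr : 1 < k * r) (hr' : ((k : ℝ) - 1) * r < 1)
    {n i : ℕ} (hi : i < n) : MeasurableSet (columnSet k r n i) :=
  Finset.measurableSet_biUnion _ fun _ hj => measurableSet_cell hr hr' hi hj

lemma columnSet_subset_Icc {k : ℕ} {r : ℝ} (hr : 1 < k * r) (hr' : ((k : ℝ) - 1) * r < 1)
    {n i : ℕ} : columnSet k r n i ⊆ Set.Icc 0 1 :=
  Set.iUnion₂_subset fun _ hj => cell_subset_Icc hr hr' hj

lemma volume_columnSet_le {k : ℕ} {r : ℝ} (hr : 1 < k * r) (hr' : ((k : ℝ) - 1) * r < 1)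
    {n i : ℕ} (hi : i < n) :
    volume (columnSet k r n i) ≤ ENNReal.ofReal (k * ((k * r - 1) / n)) := by
  refine (measure_biUnion_finset_le _ _).trans ?_
  rw [Finset.sum_congr rfl fun j hj => volume_cell hr hr' hi hj, Finset.sum_const,
    nsmul_eq_mul, ENNReal.ofReal_mul (by positivity), ENNReal.ofReal_natCast]
  gcongr
  simp

/-- The configuration `X` has the word `s`: the cell `i` of the lens `L_j` contains a single point
if the `i`-th letter of `s` is `j`, and no point otherwise. -/
def HasWord (k : ℕ) (r : ℝ) (X : Finset ℝ) (s : List ℕ) : Prop :=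
  ∀ j ∈ Finset.Icc 1 (k - 1), ∀ i < s.length,
    pointCount X (cell k r s.length j i) = if s.getD i 0 = j then 1 else 0

lemma HasWord.pointCount_lens {k : ℕ} {r : ℝ} (hr : 1 < k * r) (hr' : ((k : ℝ) - 1) * r < 1)
    {X : Finset ℝ} {s : List ℕ} (h : HasWord k r X s) (hs : 0 < s.length) {j : ℕ}
    (hj : j ∈ Finset.Icc 1 (k - 1)) : pointCount X (lens k r j) = s.count j := by
  rw [lens_eq_biUnion_cell hr hr' hs hj, pointCount_biUnion, count_eq_card_filter_range,
    Finset.card_filter]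
  · exact Finset.sum_congr rfl fun i hi => h j hj i (Finset.mem_range.1 hi)
  · intro i _ i' _ hii
    exact disjoint_cell hr hr' (x := (j, i)) (y := (j, i')) hj hj (by simpa using hii)

lemma HasWord.eq {k : ℕ} {r : ℝ} {X : Finset ℝ} {s s' : List ℕ} (h : HasWord k r X s)
    (h' : HasWord k r X s') (hlen : s.length = s'.length) (hs : ∀ a ∈ s, a ≤ k - 1)
    (hs' : ∀ a ∈ s', a ≤ k - 1) : s = s' := by
  refine List.ext_getElem hlen fun i hi hi' => ?_
  have key : ∀ j ∈ Finset.Icc 1 (k - 1), s[i] = j ↔ s'[i] = j := by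
    intro j hj
    have h1 := h j hj i hi
    have h2 := h' j hj i hi'
    rw [← hlen, h1, List.getD_eq_getElem _ _ hi, List.getD_eq_getElem _ _ hi'] at h2
    split_ifs at h2 <;> simp_all
  have h1 := hs _ (List.getElem_mem hi)
  have h2 := hs' _ (List.getElem_mem hi')
  by_cases h0 : s[i] = 0
  · by_cases h0' : s'[i] = 0
    · rw [h0, h0']
    · exact (key _ (Finset.mem_Icc.2 ⟨by omega, h2⟩)).2 rfl
  · exact ((key _ (Finset.mem_Icc.2 ⟨by omega, h1⟩)).1 rfl).symm

/-- A configuration with the prescribed numbers of points in the lenses and at most one point in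
each column has a padded word. -/
lemma exists_hasWord {k : ℕ} {r : ℝ} (hr : 1 < k * r) (hr' : ((k : ℝ) - 1) * r < 1)
    {X : Finset ℝ} {m : ℕ → ℕ} (hm : ∀ j ∈ Finset.Icc 1 (k - 1), pointCount X (lens k r j) = m j)
    {n : ℕ} (hn : 0 < n) (hn' : ∑ i ∈ Finset.Icc 1 (k - 1), m i ≤ n)
    (hcol : ∀ i < n, pointCount X (columnSet k r n i) ≤ 1) :
    ∃ s ∈ paddedWords (k - 1) m n, HasWord k r X s := by
  classical
  have hchoose : ∀ i, ∃ a ≤ k - 1, i < n → ∀ j ∈ Finset.Icc 1 (k - 1),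
      pointCount X (cell k r n j i) = if a = j then 1 else 0 := by
    intro i
    by_cases hi : i < n
    · have hsum : ∑ j ∈ Finset.Icc 1 (k - 1), pointCount X (cell k r n j i) ≤ 1 := by
        rw [← pointCount_biUnion]
        · exact hcol i hi
        · intro j hj j' hj' hjj
          exact disjoint_cell hr hr' (x := (j, i)) (y := (j', i)) hj hj' (by simpa using hjj)
      by_cases h : ∃ a ∈ Finset.Icc 1 (k - 1), pointCount X (cell k r n a i) ≠ 0
      · obtain ⟨a, ha, hne⟩ := h
        refine ⟨a, (Finset.mem_Icc.1 ha).2, fun _ j hj => ?_⟩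
        rw [← Finset.add_sum_erase _ _ ha] at hsum
        split_ifs with haj
        · subst haj
          omega
        · have := Finset.single_le_sum (f := fun j => pointCount X (cell k r n j i))
            (fun _ _ => Nat.zero_le _) (Finset.mem_erase.2 ⟨Ne.symm haj, hj⟩)
          omega
      · push Not at h
        refine ⟨0, Nat.zero_le _, fun _ j hj => ?_⟩
        rw [h j hj, if_neg]
        have := (Finset.mem_Icc.1 hj).1
        omega
    · exact ⟨0, Nat.zero_le _, fun h => absurd h hi⟩
  choose f hf hf' using hchoose
  have hlen : ((List.range n).map f).length = n := by simp
  have hword : HasWord k r X ((List.range n).map f) := by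
    intro j hj i hi
    rw [hlen] at hi ⊢
    rw [hf' i hi j hj, List.getD_eq_getElem _ _ (by simpa using hi)]
    simp
  refine ⟨_, (mem_paddedWords hn').2 ⟨?_, fun j hj => ?_, hlen⟩, hword⟩
  · intro a ha
    obtain ⟨i, -, rfl⟩ := List.mem_map.1 ha
    exact hf i
  · rw [← hword.pointCount_lens hr hr' (by omega) hj, hm j hj]

/-! ### The law of the word -/

lemma poissonMeasure_one_lt_le (v : ℝ≥0) :
    (poissonMeasure v).real {x | 1 < x} ≤ (v : ℝ) ^ 2 := by
  have hset : {x : ℕ | 1 < x} = ({0, 1} : Set ℕ)ᶜ := by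
    ext x
    simp only [Set.mem_ofPred_eq, Set.mem_compl_iff, Set.mem_insert_iff, Set.mem_singleton_iff]
    omega
  have hpair : ({0, 1} : Set ℕ) = {0} ∪ {1} := rfl
  rw [hset, probReal_compl_eq_one_sub (by measurability), hpair,
    measureReal_union (by simp) (by measurability), poissonMeasure_real_singleton,
    poissonMeasure_real_singleton]
  simp only [pow_zero, mul_one, Nat.factorial_zero, Nat.cast_one, div_one, pow_one,
    Nat.factorial_one]
  have h1 := Real.add_one_le_exp (-(v : ℝ))
  have h2 : (0 : ℝ) ≤ v := v.2
  nlinarith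

section PointCounts

variable {Ω : Type*} [MeasurableSpace Ω] {P : Measure Ω} {lam : ℝ≥0} {X : Ω → Finset ℝ}

/-- Independence of the numbers of points in disjoint sets, for an arbitrary finite index type. -/
lemma IsPoissonProcess.iIndepFun_count (hX : IsPoissonProcess P lam X) {ι : Type*} [Fintype ι]
    (B : ι → Set ℝ) (hB : ∀ i, MeasurableSet (B i)) (hB' : ∀ i, B i ⊆ Set.Icc 0 1)
    (hdisj : Pairwise fun i j => Disjoint (B i) (B j)) :
    iIndepFun (fun i ω => pointCount (X ω) (B i)) P := by
  have e := Fintype.equivFin ι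
  have h := hX.indep_count _ (fun i => B (e.symm i)) (fun i => hB _) (fun i => hB' _)
    (fun i j hij => hdisj (by simpa using hij))
  simpa using h.precomp e.injective

lemma IsPoissonProcess.measure_count_eq (hX : IsPoissonProcess P lam X) {B : Set ℝ}
    (hB : MeasurableSet B) (hB' : B ⊆ Set.Icc 0 1) (S : Set ℕ) :
    P ((fun ω => pointCount (X ω) B) ⁻¹' S) =
      poissonMeasure (lam * (volume B).toNNReal) S := by
  rw [← hX.map_count B hB hB', Measure.map_apply (hX.measurable_count B hB) (by measurability)]

lemma IsPoissonProcess.measurableSet_hasWord (hX : IsPoissonProcess P lam X) {k : ℕ} {r : ℝ}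
    (hr : 1 < k * r) (hr' : ((k : ℝ) - 1) * r < 1) (s : List ℕ) :
    MeasurableSet {ω | HasWord k r (X ω) s} := by
  have heq : {ω | HasWord k r (X ω) s} = ⋂ j ∈ Finset.Icc 1 (k - 1), ⋂ i ∈ Finset.range s.length,
      (fun ω => pointCount (X ω) (cell k r s.length j i)) ⁻¹'
        {if s.getD i 0 = j then 1 else 0} := by
    ext ω
    simp [HasWord]
  rw [heq]
  refine Finset.measurableSet_biInter _ fun j hj => Finset.measurableSet_biInter _ fun i hi => ?_
  exact hX.measurable_count _ (measurableSet_cell hr hr' (Finset.mem_range.1 hi) hj)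
    (measurableSet_singleton _)

/-- All words with the same letter counts are equally likely: the numbers of points in the cells are
independent and identically distributed. -/
lemma IsPoissonProcess.measure_hasWord (hX : IsPoissonProcess P lam X) {k : ℕ} {r : ℝ}
    (hr : 1 < k * r) (hr' : ((k : ℝ) - 1) * r < 1) (s : List ℕ) :
    P {ω | HasWord k r (X ω) s} = ∏ j ∈ Finset.Icc 1 (k - 1),
      (poissonMeasure (lam * (ENNReal.ofReal ((k * r - 1) / s.length)).toNNReal) {1} ^ s.count j *
        poissonMeasure (lam * (ENNReal.ofReal ((k * r - 1) / s.length)).toNNReal) {0} ^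
          (s.length - s.count j)) := by
  set I := Finset.Icc 1 (k - 1) ×ˢ Finset.range s.length with hI
  have hI1 : ∀ x : I, x.1.1 ∈ Finset.Icc 1 (k - 1) := fun x => (Finset.mem_product.1 x.2).1
  have hI2 : ∀ x : I, x.1.2 < s.length := fun x =>
    Finset.mem_range.1 (Finset.mem_product.1 x.2).2
  have hind := hX.iIndepFun_count (fun x : I => cell k r s.length x.1.1 x.1.2)
    (fun x => measurableSet_cell hr hr' (hI2 x) (hI1 x))
    (fun x => cell_subset_Icc hr hr' (hI1 x))
    (fun x y hxy => disjoint_cell hr hr' (hI1 x) (hI1 y) fun h => hxy (Subtype.ext h))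
  have heq : {ω | HasWord k r (X ω) s} = ⋂ x ∈ (Finset.univ : Finset I),
      (fun ω => pointCount (X ω) (cell k r s.length x.1.1 x.1.2)) ⁻¹'
        {if s.getD x.1.2 0 = x.1.1 then 1 else 0} := by
    ext ω
    simp only [Set.mem_ofPred_eq, Set.mem_iInter, Set.mem_preimage, Set.mem_singleton_iff,
      Finset.mem_univ, true_imp_iff]
    constructor
    · exact fun h x => h _ (hI1 x) _ (hI2 x)
    · exact fun h j hj i hi => h ⟨(j, i), Finset.mem_product.2 ⟨hj, Finset.mem_range.2 hi⟩⟩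
  rw [heq, iIndepFun_iff_measure_inter_preimage_eq_mul.1 hind _
    fun _ _ => measurableSet_singleton _]
  have hprob : ∀ x : I, P ((fun ω => pointCount (X ω) (cell k r s.length x.1.1 x.1.2)) ⁻¹'
      {if s.getD x.1.2 0 = x.1.1 then 1 else 0}) =
      poissonMeasure (lam * (ENNReal.ofReal ((k * r - 1) / s.length)).toNNReal)
        {if s.getD x.1.2 0 = x.1.1 then 1 else 0} := by
    intro x
    rw [hX.measure_count_eq (measurableSet_cell hr hr' (hI2 x) (hI1 x))
      (cell_subset_Icc hr hr' (hI1 x)), volume_cell hr hr' (hI2 x) (hI1 x)]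
  rw [Finset.prod_congr rfl fun x _ => hprob x, Finset.prod_coe_sort I fun x =>
    poissonMeasure (lam * (ENNReal.ofReal ((k * r - 1) / s.length)).toNNReal)
      {if s.getD x.2 0 = x.1 then 1 else 0}, hI, Finset.prod_product]
  refine Finset.prod_congr rfl fun j _ => ?_
  have hnot := Finset.card_filter_add_card_filter_not (s := Finset.range s.length)
    fun i => s.getD i 0 = j
  rw [← count_eq_card_filter_range, Finset.card_range] at hnot
  have hsplit : ∀ i, poissonMeasure (lam * (ENNReal.ofReal ((k * r - 1) / s.length)).toNNReal)
      {if s.getD i 0 = j then 1 else 0} = if s.getD i 0 = j then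
        poissonMeasure (lam * (ENNReal.ofReal ((k * r - 1) / s.length)).toNNReal) {1} else
        poissonMeasure (lam * (ENNReal.ofReal ((k * r - 1) / s.length)).toNNReal) {0} := by
    intro i
    split_ifs <;> rfl
  rw [Finset.prod_congr rfl fun i _ => hsplit i, Finset.prod_ite, Finset.prod_const,
    Finset.prod_const, ← count_eq_card_filter_range]
  congr 2
  omega

/-- The probability that some column contains two points is of order `1 / n`. -/
lemma IsPoissonProcess.measureReal_exists_column_le [IsProbabilityMeasure P]
    (hX : IsPoissonProcess P lam X) {k : ℕ} {r : ℝ} (hr : 1 < k * r)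
    (hr' : ((k : ℝ) - 1) * r < 1) {n : ℕ} (hn : 0 < n) :
    P.real (⋃ i ∈ Finset.range n, {ω | 1 < pointCount (X ω) (columnSet k r n i)}) ≤
      (lam * (k * (k * r - 1))) ^ 2 / n := by
  have hn' : (0 : ℝ) < n := by exact_mod_cast hn
  have he : 0 < k * r - 1 := by linarith
  have hcol : ∀ i ∈ Finset.range n, P.real {ω | 1 < pointCount (X ω) (columnSet k r n i)} ≤
      (lam * (k * ((k * r - 1) / n))) ^ 2 := by
    intro i hi
    rw [Finset.mem_range] at hi
    have h := hX.measure_count_eq (measurableSet_columnSet hr hr' hi)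
      (columnSet_subset_Icc hr hr') {x | 1 < x}
    have hvol : ((volume (columnSet k r n i)).toNNReal : ℝ) ≤ k * ((k * r - 1) / n) := by
      have := ENNReal.toReal_mono ENNReal.ofReal_ne_top (volume_columnSet_le hr hr' hi)
      rwa [ENNReal.toReal_ofReal (by positivity)] at this
    calc P.real {ω | 1 < pointCount (X ω) (columnSet k r n i)}
        = (poissonMeasure (lam * (volume (columnSet k r n i)).toNNReal)).real {x | 1 < x} :=
          congrArg ENNReal.toReal h
      _ ≤ _ := poissonMeasure_one_lt_le _
      _ ≤ _ := by
        exact pow_le_pow_left₀ NNReal.zero_le_coe (mul_le_mul_of_nonneg_left hvol lam.2) 2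
  calc _ ≤ ∑ i ∈ Finset.range n, P.real {ω | 1 < pointCount (X ω) (columnSet k r n i)} :=
        measureReal_biUnion_finset_le _ _
    _ ≤ ∑ i ∈ Finset.range n, (lam * (k * ((k * r - 1) / n))) ^ 2 := Finset.sum_le_sum hcol
    _ = _ := by
      rw [Finset.sum_const, Finset.card_range, nsmul_eq_mul]
      field_simp

end PointCounts

/-! ### Passage to the limit -/

/-- If a bounded function has the mean value `c` on subsets which exhaust `E` up to small
probability, then it has the mean value `c` on `E`. -/
lemma integrableOn_and_setIntegral_eq {Ω : Type*} [MeasurableSpace Ω] {P : Measure Ω}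
    [IsProbabilityMeasure P] {f : Ω → ℂ} {E : Set Ω} {G : ℕ → Set Ω}
    (hG : ∀ n, MeasurableSet (G n)) (hGE : ∀ n, G n ⊆ E)
    (hlim : Filter.Tendsto (fun n => P.real (E \ G n)) Filter.atTop (nhds 0))
    (hf : ∀ n, IntegrableOn f (G n) P) {C : ℝ} (hC : ∀ n, ∀ ω ∈ G n, ‖f ω‖ ≤ C) {c : ℂ}
    (hc : ∀ n, ∫ ω in G n, f ω ∂P = P.real (G n) * c) :
    IntegrableOn f E P ∧ ∫ ω in E, f ω ∂P = P.real E * c := by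
  have hsub : ⋃ n, G n ⊆ E := Set.iUnion_subset hGE
  have hnull : P (E \ ⋃ n, G n) = 0 := by
    have h : P.real (E \ ⋃ n, G n) ≤ 0 := ge_of_tendsto' hlim fun n =>
      measureReal_mono (Set.sdiff_subset_sdiff_right (Set.subset_iUnion G n))
    rw [← measureReal_eq_zero_iff]
    exact le_antisymm h measureReal_nonneg
  have hae : (⋃ n, G n) =ᵐ[P] E :=
    hsub.eventuallyLE.antisymm (ae_le_set.2 hnull)
  have hbound : ∀ᵐ ω ∂P.restrict E, ‖f ω‖ ≤ C := by
    rw [← Measure.restrict_congr_set hae]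
    refine ae_restrict_of_forall_mem (MeasurableSet.iUnion hG) fun ω hω => ?_
    obtain ⟨n, hn⟩ := Set.mem_iUnion.1 hω
    exact hC n ω hn
  have hint : IntegrableOn f E P := by
    refine Integrable.of_bound ?_ C hbound
    rw [← Measure.restrict_congr_set hae, aestronglyMeasurable_iUnion_iff]
    exact fun n => (hf n).aestronglyMeasurable
  refine ⟨hint, ?_⟩
  have hC' : ∀ n, ‖∫ ω in E \ G n, f ω ∂P‖ ≤ C * P.real (E \ G n) := fun n =>
    norm_setIntegral_le_of_norm_le_const_ae (measure_lt_top _ _)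
      (ae_restrict_of_ae_restrict_of_subset Set.sdiff_subset hbound)
  have h0 : Filter.Tendsto (fun n => ∫ ω in E \ G n, f ω ∂P) Filter.atTop (nhds 0) :=
    squeeze_zero_norm hC' (by simpa using hlim.const_mul C)
  have h1 : Filter.Tendsto (fun n => (P.real (E \ G n) : ℂ) * c) Filter.atTop (nhds 0) := by
    have := (Complex.continuous_ofReal.tendsto 0).comp hlim
    simpa using this.mul_const c
  have heq : ∀ n, (∫ ω in E \ G n, f ω ∂P) - P.real (E \ G n) * c =
      (∫ ω in E, f ω ∂P) - P.real E * c := by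
    intro n
    rw [setIntegral_sdiff (hG n) hint (hGE n), hc n, measureReal_sdiff (hGE n) (hG n)]
    push_cast
    ring
  have h2 := h0.sub h1
  simp only [heq, sub_zero] at h2
  exact sub_eq_zero.1 (tendsto_nhds_unique tendsto_const_nhds h2)

/-- Restricted to the configurations with a padded word of length `n`, the mean value of
`q ^ hopCount` is the average of `q ^ chainCount` over all words. -/
lemma IsPoissonProcess.setIntegral_exists_hasWord {Ω : Type*} [MeasurableSpace Ω] {P : Measure Ω}
    [IsProbabilityMeasure P] {lam : ℝ≥0} {X : Ω → Finset ℝ} (hX : IsPoissonProcess P lam X)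
    {k : ℕ} (hk : 2 ≤ k) {r : ℝ} (hr : 1 < k * r) (hr' : ((k : ℝ) - 1) * r < 1) (m : ℕ → ℕ)
    {n : ℕ} (hn : 0 < n) (hn' : ∑ i ∈ Finset.Icc 1 (k - 1), m i ≤ n) (q : ℂ) :
    IntegrableOn (fun ω => q ^ hopCount k r (X ω))
      (⋃ s ∈ paddedWords (k - 1) m n, {ω | HasWord k r (X ω) s}) P ∧
    ∫ ω in ⋃ s ∈ paddedWords (k - 1) m n, {ω | HasWord k r (X ω) s}, q ^ hopCount k r (X ω) ∂P =
      P.real (⋃ s ∈ paddedWords (k - 1) m n, {ω | HasWord k r (X ω) s}) *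
        ((∑ w ∈ words (k - 1) m, q ^ chainCount w (k - 1)) / (words (k - 1) m).card) := by
  have hmeas := hX.measurableSet_hasWord hr hr'
  have hmem : ∀ s ∈ paddedWords (k - 1) m n, (∀ a ∈ s, a ≤ k - 1) ∧
      (∀ i ∈ Finset.Icc 1 (k - 1), s.count i = m i) ∧ s.length = n :=
    fun s hs => (mem_paddedWords hn').1 hs
  have hconst : ∀ s ∈ paddedWords (k - 1) m n, Set.EqOn (fun ω => q ^ hopCount k r (X ω))
      (fun _ => q ^ chainCount s (k - 1)) {ω | HasWord k r (X ω) s} := by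
    intro s hs ω hω
    have hlen := (hmem s hs).2.2
    simp only [hopCount_eq_chainCount hr hr' hk (by omega) hω]
  have hint : ∀ s ∈ paddedWords (k - 1) m n,
      IntegrableOn (fun ω => q ^ hopCount k r (X ω)) {ω | HasWord k r (X ω) s} P := fun s hs =>
    (integrableOn_congr_fun (hconst s hs) (hmeas s)).2 (integrable_const _)
  have hdisj : (paddedWords (k - 1) m n : Set (List ℕ)).PairwiseDisjoint
      fun s => {ω | HasWord k r (X ω) s} := by
    intro s hs s' hs' hne
    rw [Function.onFun, Set.disjoint_left]
    intro ω hω hω'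
    obtain ⟨h1, -, h2⟩ := hmem s hs
    obtain ⟨h1', -, h2'⟩ := hmem s' hs'
    exact hne (HasWord.eq hω hω' (h2.trans h2'.symm) h1 h1')
  -- All padded words have the same letter counts, hence the same probability.
  obtain ⟨p, hp⟩ : ∃ p : ℝ, ∀ s ∈ paddedWords (k - 1) m n,
      P.real {ω | HasWord k r (X ω) s} = p := by
    refine ⟨(∏ j ∈ Finset.Icc 1 (k - 1),
      (poissonMeasure (lam * (ENNReal.ofReal ((k * r - 1) / n)).toNNReal) {1} ^ m j *
        poissonMeasure (lam * (ENNReal.ofReal ((k * r - 1) / n)).toNNReal) {0} ^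
          (n - m j))).toReal, fun s hs => ?_⟩
    obtain ⟨-, h2, h3⟩ := hmem s hs
    rw [Measure.real, hX.measure_hasWord hr hr', h3, Finset.prod_congr rfl fun j hj => by
      rw [h2 j hj]]
  refine ⟨integrableOn_finset_iUnion.2 hint, ?_⟩
  have hcard : ((words (k - 1) m).card : ℂ) ≠ 0 := by
    rw [card_words]
    exact_mod_cast (Nat.multinomial_pos _ _).ne'
  have hsum : ∑ s ∈ paddedWords (k - 1) m n, ∫ ω in {ω | HasWord k r (X ω) s},
      q ^ hopCount k r (X ω) ∂P = p * ∑ s ∈ paddedWords (k - 1) m n, q ^ chainCount s (k - 1) := by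
    rw [Finset.mul_sum]
    refine Finset.sum_congr rfl fun s hs => ?_
    rw [setIntegral_congr_fun (hmeas s) (hconst s hs), setIntegral_const, hp s hs,
      Complex.real_smul]
  have hone := sum_paddedWords hn' fun _ => 1
  rw [Finset.sum_const, Finset.sum_const, nsmul_one, nsmul_one] at hone
  rw [integral_biUnion_finset _ (fun s _ => hmeas s) hdisj hint, hsum,
    measureReal_biUnion_finset hdisj fun s _ => hmeas s, Finset.sum_congr rfl hp,
    Finset.sum_const, nsmul_eq_mul, Complex.ofReal_mul, Complex.ofReal_natCast, hone,
    sum_paddedWords hn' fun j => q ^ j]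
  field_simp

end RGG1d

theorem theorem2 {Ω : Type*} [MeasurableSpace Ω] (P : Measure Ω) [IsProbabilityMeasure P]
    (lam : ℝ≥0) (X : Ω → Finset ℝ) (hX : IsPoissonProcess P lam X)
    (k : ℕ) (hk : 2 ≤ k) (r : ℝ) (hr : 1 / (k : ℝ) < r) (hr' : r < 1 / ((k : ℝ) - 1))
    (m : ℕ → ℕ)
    (hm : P {ω | ∀ j ∈ Finset.Icc 1 (k - 1), pointCount (X ω) (lens k r j) = m j} ≠ 0)
    (q : ℂ) :
    Integrable (fun ω => q ^ hopCount k r (X ω))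
      (cond P {ω | ∀ j ∈ Finset.Icc 1 (k - 1), pointCount (X ω) (lens k r j) = m j}) ∧
    ∫ ω, q ^ hopCount k r (X ω)
        ∂(cond P {ω | ∀ j ∈ Finset.Icc 1 (k - 1), pointCount (X ω) (lens k r j) = m j}) =
      1 / (Nat.multinomial (Finset.Icc 1 (k - 1)) m : ℂ) *
        PowerSeries.coeff (m (k - 1)) (pathSeries (k - 2) m q) := by
  have hk1 : (2 : ℝ) ≤ k := by exact_mod_cast hk
  have hkr : 1 < k * r := (div_lt_iff₀' (by linarith)).1 hr
  have hkr' : ((k : ℝ) - 1) * r < 1 := (lt_div_iff₀' (by linarith)).1 hr'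
  set E : Set Ω := {ω | ∀ j ∈ Finset.Icc 1 (k - 1), pointCount (X ω) (lens k r j) = m j}
  set M := ∑ i ∈ Finset.Icc 1 (k - 1), m i
  -- Cut into `n + M + 1` cells per lens, which is at least the number `M` of points and positive.
  set G : ℕ → Set Ω := fun n =>
    ⋃ s ∈ paddedWords (k - 1) m (n + M + 1), {ω | HasWord k r (X ω) s}
  have hpos : ∀ n, 0 < n + M + 1 := fun n => by omega
  have hle : ∀ n, M ≤ n + M + 1 := fun n => by omega
  have hGm : ∀ n, MeasurableSet (G n) := fun n =>
    Finset.measurableSet_biUnion _ fun s _ => hX.measurableSet_hasWord hkr hkr' s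
  have hGE : ∀ n, G n ⊆ E := by
    intro n ω hω j hj
    obtain ⟨s, hs, hω⟩ := Set.mem_iUnion₂.1 hω
    obtain ⟨-, h2, h3⟩ := (mem_paddedWords (hle n)).1 hs
    rw [HasWord.pointCount_lens hkr hkr' hω (h3 ▸ hpos n) hj, h2 j hj]
  have hbad : ∀ n, P.real (E \ G n) ≤ (lam * (k * (k * r - 1))) ^ 2 / ((n + M + 1 : ℕ) : ℝ) := by
    intro n
    refine le_trans (measureReal_mono ?_ (measure_ne_top _ _))
      (hX.measureReal_exists_column_le hkr hkr' (hpos n))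
    rintro ω ⟨hωE, hωG⟩
    by_contra hcol
    simp only [Set.mem_iUnion, Finset.mem_range, Set.mem_ofPred_eq, not_exists, not_lt] at hcol
    obtain ⟨s, hs, hω⟩ := exists_hasWord hkr hkr' hωE (hpos n) (hle n) hcol
    exact hωG (Set.mem_iUnion₂.2 ⟨s, hs, hω⟩)
  have hlim : Filter.Tendsto (fun n => P.real (E \ G n)) Filter.atTop (nhds 0) := by
    refine squeeze_zero (fun _ => measureReal_nonneg) hbad ?_
    exact (tendsto_const_div_atTop_nhds_zero_nat _).comp (Filter.tendsto_add_atTop_nat (M + 1))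
  have hbound : ∀ n, ∀ ω ∈ G n, ‖q ^ hopCount k r (X ω)‖ ≤
      ∑ w ∈ words (k - 1) m, ‖q ^ chainCount w (k - 1)‖ := by
    intro n ω hω
    obtain ⟨s, hs, hω⟩ := Set.mem_iUnion₂.1 hω
    obtain ⟨w, hw, hsw⟩ := exists_word_of_mem_paddedWords hs
    have hlen := ((mem_paddedWords (hle n)).1 hs).2.2
    rw [hopCount_eq_chainCount hkr hkr' hk (hlen ▸ hpos n) hω, hsw]
    exact Finset.single_le_sum (f := fun w => ‖q ^ chainCount w (k - 1)‖)
      (fun _ _ => norm_nonneg _) hw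
  obtain ⟨hint, heq⟩ := integrableOn_and_setIntegral_eq hGm hGE hlim
    (fun n => (hX.setIntegral_exists_hasWord hk hkr hkr' m (hpos n) (hle n) q).1) hbound
    (fun n => (hX.setIntegral_exists_hasWord hk hkr hkr' m (hpos n) (hle n) q).2)
  refine ⟨hint.smul_measure (ENNReal.inv_ne_top.2 hm), ?_⟩
  have hreal : (P.real E : ℂ) ≠ 0 := by
    rw [Complex.ofReal_ne_zero]
    exact (measureReal_ne_zero_iff).2 hm
  have hcoeff := coeff_pathSeries (k - 2) m q
  rw [show k - 2 + 1 = k - 1 by omega] at hcoeff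
  rw [ProbabilityTheory.cond, integral_smul_measure, heq, hcoeff, ENNReal.toReal_inv,
    ← Measure.real, Complex.real_smul, Complex.ofReal_inv, inv_mul_cancel_left₀ hreal,
    card_words, div_eq_inv_mul,
    one_div]
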